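/- Let $d\ge 1$, let $1\le p\le\infty$ and let $\|\cdot\|$ be the $l^p$-norm on $\mathbb{R}^d$. Let $X_1,X_2,\dots$ be i.i.d. random vectors in $\mathbb{R}^d$ with a common (essentially) bounded probability density function $f$, and let $(r_n)$ be a sequence of non-negative numbers with $r_n\to 0$. Let $G_n$ be the random geometric graph with vertices $X_1,\dots,X_n$ in which $X_i$ and $X_j$ ($i\ne j$) are adjacent if and only if $\|X_i-X_j\|<r_n$. For a graph $G$ and an integer $l\ge 1$, let $\chi(G)$ be the chromatic number of $G$, and let $\chi_l(G)$ be the distant-$l$ chromatic number, that is, the least number of colors in a vertex coloring of $G$ in which any two distinct vertices at graph distance at most $l$ have different colors. **Theorem 4 (Subconnectivity regime).** Suppose that $n^{-\varepsilon}=o(nr_n^d)$ for every $\varepsilon>0$ and that $nr_n^d=o(\ln n)$ as $n\to\infty$, and let $l\ge 1$ be a fixed integer. Then, almost surely, $$\frac{\chi_l(G_n)}{\chi(G_n)}\longrightarrow 1\qquad\text{as } n\to\infty .$$ -/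

import Mathlib

open MeasureTheory ProbabilityTheory Filter Asymptotics
open scoped ENNReal Topology

/-- A distant-`l` coloring of `G`: distinct vertices at graph distance at most `l` get different
colors. The extended distance `edist` is `⊤` between different components. -/
def IsDistantColoring {V C : Type*} (G : SimpleGraph V) (l : ℕ) (g : V → C) : Prop :=
  ∀ u v : V, u ≠ v → G.edist u v ≤ (l : ℕ∞) → g u ≠ g v

/-- The distant-`l` chromatic number: the least number `k` of colors for which a distant-`l`
coloring exists (`⊤` if there is none, which cannot happen on a finite vertex set). -/
noncomputable def distantChromaticNumber {V : Type*} (G : SimpleGraph V) (l : ℕ) : ℕ∞ :=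
  ⨅ k ∈ {k : ℕ | ∃ g : V → Fin k, IsDistantColoring G l g}, (k : ℕ∞)

/-- The geometric graph on points `x i` of `ℝ^d`: `i ≠ j` are adjacent iff the `l^p`-distance of
`x i` and `x j` is less than `r`. -/
def geometricGraph {d : ℕ} {ι : Type*} (p : ℝ≥0∞) (x : ι → Fin d → ℝ) (r : ℝ) :
    SimpleGraph ι where
  Adj i j := i ≠ j ∧ ‖WithLp.toLp p (x i - x j)‖ < r
  symm := by
    constructor
    rintro i j ⟨hij, h⟩
    refine ⟨hij.symm, ?_⟩
    have key : ‖WithLp.toLp p (x j - x i)‖ = ‖WithLp.toLp p (x i - x j)‖ := by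
      rcases p.trichotomy with rfl | rfl | hp
      · simp only [PiLp.norm_eq_card, Pi.sub_apply, norm_sub_rev]
      · simp only [PiLp.norm_eq_ciSup, Pi.sub_apply, norm_sub_rev]
      · simp only [PiLp.norm_eq_sum hp, Pi.sub_apply, norm_sub_rev]
    rwa [key]
  loopless := ⟨fun i h => h.1 rfl⟩

/-- The random geometric graph on the first `n` points of the sequence `X`, at the outcome `ω`. -/
def randomGeometricGraph {Ω : Type*} {d : ℕ} (p : ℝ≥0∞) (X : ℕ → Ω → Fin d → ℝ) (r : ℕ → ℝ)
    (n : ℕ) (ω : Ω) : SimpleGraph (Fin n) :=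
  geometricGraph p (fun i : Fin n => X i ω) (r n)

/-! ### Greedy colorings, cliques and comparison of norms. -/

section Deterministic

/-! Put a_n = n r_n^d and k_n = log n / log (log n / a_n), which is `clusterSize`. A region whose
mean number of points is of order a_n holds m points with probability roughly (const · a_n / m)^m.
At m = t k_n this is n^(-t+o(1)) whatever the constant, since log n / a_n → ∞ makes the logarithm
absorb it. So the largest cluster in a ball of radius of order r_n has size about k_n, both at the
scale of cliques and at the scale of l-step neighbourhoods: the factor l only changes the constant.
As χ ≤ χ_l for l ≥ 1, it is enough that almost surely, eventually, χ ≥ ⌊(1-ε) k_n⌋ and χ_l ≤ ⌈(1+ε)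
k_n⌉. The lower condition on a_n gives k_n → ∞, which makes the rounding harmless.

Upper bound: greedy coloring needs only that no point has m others within a radius above l r_n. The
first-moment bound for this is n^(-ε/2), which need not be summable in n; it is therefore applied
only at dyadic sample sizes and dyadic radii (`ae_eventually_forall_dyadic_notMem_crowdedEvent`),
and monotonicity covers the rest.

Lower bound: points in a cube of side r_n/(d+1) form a clique. About n^(1-ε/4) disjoint cubes carry
mass of order r_n^d, and each holds (1-ε) k_n points with probability at least n^(-1+ε/2). The
dependence between cubes is handled by revealing them one at a time
(`measureReal_forall_count_lt_le`); failure then has probability at most n^(-2), and Borel–Cantelli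
applies. -/

theorem exists_coloring_of_card_lt {V : Type*} [Fintype V] (R : V → V → Prop)
    (hR : ∀ u v, R u v → R v u) (D : ℕ)
    (hD : ∀ v, Set.ncard {u | u ≠ v ∧ R u v} < D) :
    ∃ g : V → Fin D, ∀ u v, u ≠ v → R u v → g u ≠ g v := by
  classical
  suffices h : ∀ s : Finset V, ∃ g : V → Fin D,
      ∀ u ∈ s, ∀ v ∈ s, u ≠ v → R u v → g u ≠ g v by
    obtain ⟨g, hg⟩ := h Finset.univ
    exact ⟨g, fun u v => hg u (Finset.mem_univ _) v (Finset.mem_univ _)⟩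
  intro s
  induction s using Finset.induction_on with
  | empty => exact ⟨fun v => ⟨0, (Nat.zero_le _).trans_lt (hD v)⟩, by simp⟩
  | insert a s ha ih =>
    obtain ⟨g, hg⟩ := ih
    let B : Finset V := s.filter fun u => R u a
    have hB : (B.image g).card < Fintype.card (Fin D) := by
      rw [Fintype.card_fin]
      refine Finset.card_image_le.trans_lt (lt_of_le_of_lt ?_ (hD a))
      rw [← Set.ncard_coe_finset]
      refine Set.ncard_le_ncard (fun u hu => ?_) (Set.toFinite _)
      have hu' := Finset.mem_filter.1 (Finset.mem_coe.1 hu)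
      exact ⟨fun h => ha (h ▸ hu'.1), hu'.2⟩
    obtain ⟨c, -, hc⟩ := Finset.exists_mem_notMem_of_card_lt_card
      (s := B.image g) (t := Finset.univ) (by simpa using hB)
    have hne : ∀ u ∈ s, u ≠ a := fun u hu h => ha (h ▸ hu)
    have hcol : ∀ u ∈ s, R u a → g u ≠ c := fun u hu h hgc =>
      hc (Finset.mem_image.2 ⟨u, Finset.mem_filter.2 ⟨hu, h⟩, hgc⟩)
    refine ⟨Function.update g a c, fun u hu v hv huv h => ?_⟩
    rcases Finset.mem_insert.1 hu with rfl | hu' <;>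
      rcases Finset.mem_insert.1 hv with rfl | hv'
    · exact absurd rfl huv
    · rw [Function.update_self, Function.update_of_ne (hne v hv')]
      exact (hcol v hv' (hR _ _ h)).symm
    · rw [Function.update_self, Function.update_of_ne (hne u hu')]
      exact hcol u hu' h
    · rw [Function.update_of_ne (hne u hu'), Function.update_of_ne (hne v hv')]
      exact hg u hu' v hv' huv h

theorem distantChromaticNumber_le {V : Type*} {G : SimpleGraph V} {l k : ℕ} {g : V → Fin k}
    (hg : IsDistantColoring G l g) : distantChromaticNumber G l ≤ k :=
  iInf₂_le k ⟨g, hg⟩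

theorem chromaticNumber_le_distantChromaticNumber {V : Type*} (G : SimpleGraph V) {l : ℕ}
    (hl : 1 ≤ l) : G.chromaticNumber ≤ distantChromaticNumber G l := by
  refine le_iInf₂ fun k ⟨g, hg⟩ => ?_
  refine SimpleGraph.chromaticNumber_le_iff_colorable.2 ⟨SimpleGraph.Coloring.mk g ?_⟩
  intro u v huv
  refine hg u v huv.ne ?_
  rw [SimpleGraph.edist_eq_one_iff_adj.2 huv]
  exact_mod_cast hl

theorem norm_le_norm_toLp {d : ℕ} {p : ℝ≥0∞} (hp : 1 ≤ p) (v : Fin d → ℝ) :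
    ‖v‖ ≤ ‖WithLp.toLp p v‖ := by
  have : Fact (1 ≤ p) := ⟨hp⟩
  refine (pi_norm_le_iff_of_nonneg (norm_nonneg _)).2 fun i => ?_
  exact PiLp.norm_apply_le (WithLp.toLp p v) i

theorem norm_toLp_le_mul_norm {d : ℕ} {p : ℝ≥0∞} (hp : 1 ≤ p) (v : Fin d → ℝ) :
    ‖WithLp.toLp p v‖ ≤ d * ‖v‖ := by
  have : Fact (1 ≤ p) := ⟨hp⟩
  have h : WithLp.toLp p v = ∑ i, WithLp.toLp p (Pi.single i (v i)) := by
    rw [← WithLp.toLp_sum, Finset.univ_sum_single]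
  rw [h]
  refine (norm_sum_le _ _).trans ?_
  calc ∑ i, ‖WithLp.toLp p (Pi.single i (v i) : Fin d → ℝ)‖ ≤ ∑ _i : Fin d, ‖v‖ := by
        refine Finset.sum_le_sum fun i _ => ?_
        exact (PiLp.norm_single p (fun _ => ℝ) i (v i)).trans_le (norm_le_pi_norm v i)
    _ = d * ‖v‖ := by simp

theorem norm_sub_le_of_edist_le {d : ℕ} {ι : Type*} {p : ℝ≥0∞} (hp : 1 ≤ p)
    (x : ι → Fin d → ℝ) {r : ℝ} (hr : 0 ≤ r) {l : ℕ} {u v : ι}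
    (h : (geometricGraph p x r).edist u v ≤ l) : ‖x u - x v‖ ≤ l * r := by
  obtain ⟨w, hw⟩ := SimpleGraph.exists_walk_of_edist_ne_top
    (ne_top_of_le_ne_top (ENat.natCast_ne_top l) h)
  have hwl : w.length ≤ l := by
    rw [← hw] at h
    exact_mod_cast h
  have key : ∀ {a b : ι} (w : (geometricGraph p x r).Walk a b),
      ‖x a - x b‖ ≤ w.length * r := by
    intro a b w
    induction w with
    | nil => simp
    | @cons a b c hab w ih =>
      have h1 : ‖x a - x b‖ ≤ r := (norm_le_norm_toLp hp _).trans hab.2.le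
      calc ‖x a - x c‖ ≤ ‖x a - x b‖ + ‖x b - x c‖ := norm_sub_le_norm_sub_add_norm_sub _ _ _
        _ ≤ r + w.length * r := add_le_add h1 ih
        _ = _ := by rw [SimpleGraph.Walk.length_cons]; push_cast; ring
  exact (key w).trans (mul_le_mul_of_nonneg_right (by exact_mod_cast hwl) hr)

/-- If every point has fewer than `D` other points in a ball that is slightly larger than the
`l`-step neighbourhood, then `D` colors suffice. -/
theorem distantChromaticNumber_geometricGraph_le {d : ℕ} {ι : Type*} [Fintype ι] {p : ℝ≥0∞}
    (hp : 1 ≤ p) (x : ι → Fin d → ℝ) {r : ℝ} (hr : 0 ≤ r) {l : ℕ} {R : ℝ} (hR : l * r < R) (D : ℕ)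
    (hD : ∀ v, Set.ncard {u | u ≠ v ∧ dist (x u) (x v) < R} < D) :
    distantChromaticNumber (geometricGraph p x r) l ≤ D := by
  obtain ⟨g, hg⟩ := exists_coloring_of_card_lt (fun u v => dist (x u) (x v) < R)
    (fun u v h => by rwa [dist_comm]) D hD
  refine distantChromaticNumber_le (g := g) fun u v huv h => hg u v huv ?_
  rw [dist_eq_norm]
  exact (norm_sub_le_of_edist_le hp x hr h).trans_lt hR

/-- The points with coordinates in the box `∏ i, [s z i, s (z i + 1))`. -/
def gridCube {d : ℕ} (s : ℝ) (z : Fin d → ℤ) : Set (Fin d → ℝ) :=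
  {x | ∀ i, ⌊x i / s⌋ = z i}

theorem norm_sub_le_of_mem_gridCube {d : ℕ} {s : ℝ} (hs : 0 < s) {z : Fin d → ℤ}
    {x y : Fin d → ℝ} (hx : x ∈ gridCube s z) (hy : y ∈ gridCube s z) : ‖x - y‖ ≤ s := by
  refine (pi_norm_le_iff_of_nonneg hs.le).2 fun i => ?_
  have h := Int.abs_sub_lt_one_of_floor_eq_floor ((hx i).trans (hy i).symm)
  rw [← sub_div, abs_div, abs_of_pos hs, div_lt_one hs] at h
  exact h.le

/-- The l^p-norm is at most d times the sup norm for every p ≥ 1, so side r/(d+1) makes a cube a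
clique, with d+1 giving the strict inequality. -/
theorem card_le_chromaticNumber_geometricGraph {d : ℕ} {ι : Type*} {p : ℝ≥0∞}
    (hp : 1 ≤ p) (x : ι → Fin d → ℝ) {r : ℝ} (hr : 0 < r) (z : Fin d → ℤ) (S : Finset ι)
    (hS : ∀ i ∈ S, x i ∈ gridCube (r / (d + 1)) z) :
    (S.card : ℕ∞) ≤ (geometricGraph p x r).chromaticNumber := by
  refine SimpleGraph.IsClique.card_le_chromaticNumber fun i hi j hj hij => ⟨hij, ?_⟩
  have hd : (0 : ℝ) < d + 1 := by positivity
  have h1 := norm_sub_le_of_mem_gridCube (div_pos hr hd) (hS i hi) (hS j hj)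
  calc ‖WithLp.toLp p (x i - x j)‖ ≤ d * ‖x i - x j‖ := norm_toLp_le_mul_norm hp _
    _ ≤ d * (r / (d + 1)) := by gcongr
    _ < r := by rw [← mul_div_assoc, div_lt_iff₀ hd]; nlinarith

end Deterministic

/-! ### Lower tails of the binomial distribution. -/

section BinomialTail

/-- The probability that a binomial variable with parameters `N` and `p` is less than `m`. -/
noncomputable def binomialLt (N m : ℕ) (p : ℝ) : ℝ :=
  ∑ s ∈ Finset.range m, (N.choose s : ℝ) * p ^ s * (1 - p) ^ (N - s)

theorem binomialLt_mono_right (N : ℕ) {m m' : ℕ} (h : m ≤ m') {p : ℝ} (hp0 : 0 ≤ p) (hp1 : p ≤ 1) :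
    binomialLt N m p ≤ binomialLt N m' p := by
  have : 0 ≤ 1 - p := sub_nonneg.2 hp1
  exact Finset.sum_le_sum_of_subset_of_nonneg (Finset.range_subset_range.2 h)
    fun i _ _ => by positivity

/-- Condition on the outcome of one trial. -/
theorem binomialLt_succ_succ (N m : ℕ) (p : ℝ) :
    binomialLt (N + 1) (m + 1) p = p * binomialLt N m p + (1 - p) * binomialLt N (m + 1) p := by
  unfold binomialLt
  rw [Finset.sum_range_succ', Finset.sum_range_succ' _ m, mul_add, ← add_assoc, Finset.mul_sum,
    Finset.mul_sum, ← Finset.sum_add_distrib]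
  congr 1
  · refine Finset.sum_congr rfl fun s _ => ?_
    rw [Nat.choose_succ_succ, Nat.succ_sub_succ]
    rcases lt_or_ge s N with h | h
    · obtain ⟨t, rfl⟩ := Nat.exists_eq_add_of_lt h
      rw [show s + t + 1 - s = t + 1 by omega, show s + t + 1 - (s + 1) = t by omega]
      push_cast
      ring
    · rw [Nat.choose_eq_zero_of_lt (Nat.lt_succ_of_le h)]
      push_cast
      ring
  · simp [pow_succ]
    ring

/-- Induction on N through the one-trial recursion: raising p moves weight from the tail at m+1 to
the smaller tail at m. -/
theorem binomialLt_antitone (N : ℕ) : ∀ (m : ℕ) {p p' : ℝ}, 0 ≤ p → p ≤ p' → p' ≤ 1 →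
    binomialLt N m p' ≤ binomialLt N m p := by
  induction N with
  | zero =>
    intro m p p' _ _ _
    unfold binomialLt
    refine (Finset.sum_congr rfl fun s _ => ?_).le
    rcases s with _ | s <;> simp
  | succ N ih =>
    intro m p p' h0 h1 h2
    rcases m with _ | m
    · simp [binomialLt]
    rw [binomialLt_succ_succ, binomialLt_succ_succ]
    have e1 := ih m h0 h1 h2
    have e2 := ih (m + 1) h0 h1 h2
    have e3 := binomialLt_mono_right N (Nat.le_succ m) h0 (h1.trans h2)
    have h3 : 0 ≤ 1 - p' := sub_nonneg.2 h2
    nlinarith [mul_le_mul_of_nonneg_left e1 (h0.trans h1), mul_le_mul_of_nonneg_left e2 h3,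
      mul_nonneg (sub_nonneg.2 h1) (sub_nonneg.2 e3)]

theorem binomialLt_le_one_sub {N m : ℕ} (hm : m ≤ N) {p : ℝ} (hp0 : 0 ≤ p) (hp1 : p ≤ 1) :
    binomialLt N m p ≤ 1 - (N.choose m : ℝ) * p ^ m * (1 - p) ^ (N - m) := by
  have : 0 ≤ 1 - p := sub_nonneg.2 hp1
  have h1 : binomialLt N (N + 1) p = 1 := by
    have := add_pow p (1 - p) N
    rw [add_sub_cancel, one_pow] at this
    rw [this]
    exact Finset.sum_congr rfl fun s _ => by ring
  have h2 := binomialLt_mono_right N (Nat.succ_le_succ hm) hp0 hp1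
  have h3 : binomialLt N (m + 1) p = binomialLt N m p +
      (N.choose m : ℝ) * p ^ m * (1 - p) ^ (N - m) := Finset.sum_range_succ _ _
  linarith

end BinomialTail

/-! ### Simultaneous low occupancy of disjoint cells. -/

section Occupancy

variable {Ω E κ : Type*} [MeasurableSpace Ω] [MeasurableSpace E] {μ : Measure Ω}
  {ν : Measure E} {X : ℕ → Ω → E}

theorem measurableSet_pi_forall_mem_and_count_lt {ι : Type*} [Fintype ι] {U : Set E}
    (hU : MeasurableSet U) {A : κ → Set E} (hA : ∀ j, MeasurableSet (A j)) (T : Finset κ) (m : ℕ) :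
    MeasurableSet {y : ι → E | (∀ i, y i ∈ U) ∧
      ∀ j ∈ T, ∑ i, (A j).indicator (fun _ => (1 : ℕ)) (y i) < m} := by
  rw [Set.ofPred_and]
  refine MeasurableSet.inter ?_ ?_
  · rw [Set.ofPred_forall]
    exact MeasurableSet.iInter fun i => measurable_pi_apply i hU
  · have h : {y : ι → E | ∀ j ∈ T, ∑ i, (A j).indicator (fun _ => (1 : ℕ)) (y i) < m} =
        ⋂ j ∈ T, {y | ∑ i, (A j).indicator (fun _ => (1 : ℕ)) (y i) < m} := by ext; simp
    rw [h]
    refine T.measurableSet_biInter fun j _ => measurableSet_lt ?_ measurable_const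
    exact Finset.measurable_sum _ fun i _ =>
      (measurable_const.indicator (hA j)).comp (measurable_pi_apply i)

theorem measureReal_forall_mem (hXm : ∀ i, Measurable (X i)) (hXν : ∀ i, μ.map (X i) = ν)
    (hind : iIndepFun X μ) {U : Set E} (hU : MeasurableSet U) (S : Finset ℕ) :
    μ.real {ω | ∀ i ∈ S, X i ω ∈ U} = ν.real U ^ S.card := by
  have h := hind.measure_inter_preimage_eq_mul S (sets := fun _ => U) fun _ _ => hU
  have h2 : {ω | ∀ i ∈ S, X i ω ∈ U} = ⋂ i ∈ S, X i ⁻¹' U := by ext; simp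
  rw [h2, Measure.real, h, ENNReal.toReal_prod]
  refine Finset.prod_eq_pow_card fun i _ => ?_
  rw [← Measure.map_apply (hXm i) hU, hXν i, Measure.real]

/-- For an i.i.d. sample and disjoint sets `A j` of measure at least `q`, the probability that
every `A j` receives fewer than `m` points is at most the product of the individual bounds. -/
theorem measureReal_forall_count_lt_le [IsProbabilityMeasure μ] [DecidableEq κ] (hXm : ∀ i, Measurable (X i))
    (hXν : ∀ i, μ.map (X i) = ν) (hind : iIndepFun X μ) {A : κ → Set E}
    (hA : ∀ j, MeasurableSet (A j)) (hdisj : Pairwise fun i j => Disjoint (A i) (A j))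
    {m n₀ n₁ : ℕ} {q γ : ℝ} (hq : 0 < q) (hγ0 : 0 ≤ γ)
    (hγ : ∀ N, n₀ ≤ N → N ≤ n₁ → ∀ t, q ≤ t → t ≤ 1 → binomialLt N m t ≤ γ) (T : Finset κ) :
    (∀ j ∈ T, q ≤ ν.real (A j)) → ∀ U, MeasurableSet U → (∀ j ∈ T, A j ⊆ U) →
    ∀ I : Finset ℕ, n₀ + m * T.card ≤ I.card → I.card ≤ n₁ →
    μ.real {ω | (∀ i ∈ I, X i ω ∈ U) ∧
      ∀ j ∈ T, ∑ i ∈ I, (A j).indicator (fun _ => (1 : ℕ)) (X i ω) < m} ≤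
      ν.real U ^ I.card * γ ^ T.card := by
  have hν : IsProbabilityMeasure ν := hXν 0 ▸ Measure.isProbabilityMeasure_map (hXm 0).aemeasurable
  induction T using Finset.induction_on with
  | empty =>
    intro _ U hU _ I _ _
    simp only [Finset.notMem_empty, false_imp_iff, implies_true, and_true, Finset.card_empty,
      pow_zero, mul_one]
    exact (measureReal_forall_mem hXm hXν hind hU I).le
  | insert a T ha ih =>
    intro hqA U hU hAU I hI hI1
    rw [Finset.card_insert_of_notMem ha] at hI ⊢
    -- Split the event according to the exact set S of indices falling in the cell `A a`; the other
    -- points must then lie in `U \ A a`, which is why the induction carries a general U.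
    set P := (I.powerset).filter fun S => S.card < m with hP
    let F : Finset ℕ → Set Ω := fun S => {ω | ∀ i ∈ S, X i ω ∈ A a}
    let H : Finset ℕ → Set Ω := fun S => {ω | (∀ i ∈ I \ S, X i ω ∈ U \ A a) ∧
      ∀ j ∈ T, ∑ i ∈ I \ S, (A j).indicator (fun _ => (1 : ℕ)) (X i ω) < m}
    have hsub : {ω | (∀ i ∈ I, X i ω ∈ U) ∧
        ∀ j ∈ insert a T, ∑ i ∈ I, (A j).indicator (fun _ => (1 : ℕ)) (X i ω) < m} ⊆
        ⋃ S ∈ P, F S ∩ H S := by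
      classical
      rintro ω ⟨h1, h2⟩
      simp only [Set.mem_iUnion]
      refine ⟨I.filter fun i => X i ω ∈ A a, ?_, ?_, ?_, ?_⟩
      · refine Finset.mem_filter.2 ⟨Finset.mem_powerset.2 (Finset.filter_subset _ _), ?_⟩
        have := h2 a (Finset.mem_insert_self _ _)
        rw [Finset.card_filter]
        simpa only [Set.indicator_apply] using this
      · exact fun i hi => (Finset.mem_filter.1 hi).2
      · intro i hi
        obtain ⟨hi1, hi2⟩ := Finset.mem_sdiff.1 hi
        exact ⟨h1 i hi1, fun h => hi2 (Finset.mem_filter.2 ⟨hi1, h⟩)⟩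
      · intro j hj
        exact (Finset.sum_le_sum_of_subset Finset.sdiff_subset).trans_lt
          (h2 j (Finset.mem_insert_of_mem hj))
    have hterm : ∀ S ∈ P, μ.real (F S ∩ H S) ≤
        ν.real (A a) ^ S.card * (ν.real (U \ A a) ^ (I.card - S.card) * γ ^ T.card) := by
      intro S hS
      obtain ⟨hSI, hSm⟩ := Finset.mem_filter.1 hS
      rw [Finset.mem_powerset] at hSI
      have hcard : (I \ S).card = I.card - S.card := Finset.card_sdiff_of_subset hSI
      have hSle := Finset.card_le_card hSI
      -- Fewer than m indices are used up by one cell, so the reserve of m points per remaining cell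
      -- in the bound on `I.card` survives.
      have hih := ih (fun j hj => hqA j (Finset.mem_insert_of_mem hj)) (U \ A a)
        (hU.diff (hA a)) (fun j hj x hx => ⟨hAU j (Finset.mem_insert_of_mem hj) hx, fun hxa =>
          Set.disjoint_left.1 (hdisj (fun h : j = a => ha (h ▸ hj))) hx hxa⟩) (I \ S)
        (by rw [hcard]; rw [mul_add] at hI; omega) (by rw [hcard]; omega)
      have hindep := hind.indepFun_finset S (I \ S) Finset.disjoint_sdiff hXm
      have hF : F S = (fun ω (i : S) => X i ω) ⁻¹' {y | ∀ i, y i ∈ A a} := by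
        ext ω; simp [F]
      have hH : H S = (fun ω (i : (I \ S : Finset ℕ)) => X i ω) ⁻¹'
          {y | (∀ i, y i ∈ U \ A a) ∧
            ∀ j ∈ T, ∑ i, (A j).indicator (fun _ => (1 : ℕ)) (y i) < m} := by
        ext ω
        have hs : ∀ j, ∑ i : (I \ S : Finset ℕ), (A j).indicator (fun _ => (1 : ℕ)) (X i ω) =
            ∑ i ∈ I \ S, (A j).indicator (fun _ => (1 : ℕ)) (X i ω) := fun j =>
          Finset.sum_coe_sort (I \ S) fun i => (A j).indicator (fun _ => (1 : ℕ)) (X i ω)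
        simp only [H, Set.mem_ofPred_eq, Set.mem_preimage, hs, Subtype.forall]
      have hmul : μ.real (F S ∩ H S) = μ.real (F S) * μ.real (H S) := by
        rw [Measure.real, hF, hH, hindep.measure_inter_preimage_eq_mul, ENNReal.toReal_mul]
        · rfl
        · rw [Set.ofPred_forall]
          exact MeasurableSet.iInter fun i => measurable_pi_apply i (hA a)
        · exact measurableSet_pi_forall_mem_and_count_lt (hU.diff (hA a)) hA T m
      rw [hmul, ← hcard]
      exact mul_le_mul (measureReal_forall_mem hXm hXν hind (hA a) S).le hih
        measureReal_nonneg (by positivity)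
    have haU : A a ⊆ U := hAU a (Finset.mem_insert_self _ _)
    have hqa : q ≤ ν.real (A a) := hqA a (Finset.mem_insert_self _ _)
    have hdiff : ν.real (U \ A a) = ν.real U - ν.real (A a) :=
      measureReal_sdiff haU (hA a)
    have haUle : ν.real (A a) ≤ ν.real U := measureReal_mono haU
    have hUpos : 0 < ν.real U := hq.trans_le (hqa.trans haUle)
    have hU1 : ν.real U ≤ 1 := measureReal_le_one
    have hmI : m ≤ I.card := by rw [mul_add] at hI; omega
    -- Group by cardinality and factor out ν(U)^|I|: what remains is a binomial tail with the
    -- conditional probability ν(A a)/ν(U), at least q because ν(U) ≤ 1.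
    have hsum : ∑ S ∈ P, ν.real (A a) ^ S.card * ν.real (U \ A a) ^ (I.card - S.card) =
        ν.real U ^ I.card * binomialLt I.card m (ν.real (A a) / ν.real U) := by
      rw [hP, Finset.sum_filter, Finset.sum_powerset_apply_card (fun s => if s < m then
        ν.real (A a) ^ s * ν.real (U \ A a) ^ (I.card - s) else 0), binomialLt, Finset.mul_sum]
      simp only [smul_ite, smul_zero]
      rw [← Finset.sum_filter]
      have hr : (Finset.range (I.card + 1)).filter (fun s => s < m) = Finset.range m := by
        ext s; simp; omega
      rw [hr]
      refine Finset.sum_congr rfl fun s hs => ?_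
      have hsI : s ≤ I.card := (Finset.mem_range.1 hs).le.trans hmI
      have e1 : 1 - ν.real (A a) / ν.real U = (ν.real U - ν.real (A a)) / ν.real U := by
        field_simp
      rw [hdiff, e1, div_pow, div_pow, nsmul_eq_mul]
      conv_rhs => rw [← Nat.add_sub_cancel' hsI, pow_add, Nat.add_sub_cancel' hsI]
      field_simp
    calc _ ≤ μ.real (⋃ S ∈ P, F S ∩ H S) := measureReal_mono hsub (measure_ne_top _ _)
      _ ≤ ∑ S ∈ P, μ.real (F S ∩ H S) := measureReal_biUnion_finset_le _ _
      _ ≤ ∑ S ∈ P, ν.real (A a) ^ S.card * (ν.real (U \ A a) ^ (I.card - S.card) * γ ^ T.card) :=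
        Finset.sum_le_sum hterm
      _ = (∑ S ∈ P, ν.real (A a) ^ S.card * ν.real (U \ A a) ^ (I.card - S.card)) *
          γ ^ T.card := by
        rw [Finset.sum_mul]
        exact Finset.sum_congr rfl fun _ _ => by ring
      _ ≤ ν.real U ^ I.card * γ ^ (T.card + 1) := by
        rw [hsum, pow_succ, mul_assoc, mul_comm (γ ^ _) γ]
        gcongr
        refine hγ _ (by omega) hI1 _ ?_ ((div_le_one hUpos).2 haUle)
        rw [le_div_iff₀ hUpos]
        nlinarith

end Occupancy

/-! ### Union bound for crowded points. -/

section FirstMoment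

variable {Ω E : Type*} [MeasurableSpace Ω] [PseudoMetricSpace E] [SecondCountableTopology E]
  [MeasurableSpace E] [OpensMeasurableSpace E] {μ : Measure Ω}
  [IsProbabilityMeasure μ] {ν : Measure E} {X : ℕ → Ω → E}

/-- Integrate over the position of X a, which is independent of the others: given X a, each of the
points in S lies in a fixed ball independently. -/
theorem measureReal_forall_dist_lt_le (hXm : ∀ i, Measurable (X i))
    (hXν : ∀ i, μ.map (X i) = ν) (hind : iIndepFun X μ) {R B : ℝ}
    (hB : ∀ x, ν.real (Metric.ball x R) ≤ B) {a : ℕ} {S : Finset ℕ} (haS : a ∉ S) :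
    μ.real {ω | ∀ b ∈ S, dist (X b ω) (X a ω) < R} ≤ B ^ S.card := by
  have hν : IsProbabilityMeasure ν := hXν 0 ▸ Measure.isProbabilityMeasure_map (hXm 0).aemeasurable
  have hB0 : 0 ≤ B := by
    obtain ⟨ω⟩ := nonempty_of_isProbabilityMeasure μ
    exact measureReal_nonneg.trans (hB (X 0 ω))
  have hindep := hind.indepFun_finset S {a} (Finset.disjoint_singleton_right.2 haS) hXm
  have hindep' : IndepFun (X a) (fun ω (i : S) => X i ω) μ := by
    have hm : Measurable fun y : (({a} : Finset ℕ) → E) => y ⟨a, Finset.mem_singleton_self a⟩ :=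
      measurable_pi_apply _
    exact (hindep.comp measurable_id hm).symm
  have hYm : Measurable (fun ω (i : S) => X i ω) := measurable_pi_iff.2 fun i => hXm i
  have hmap := (indepFun_iff_map_prod_eq_prod_map_map (hXm a).aemeasurable
    hYm.aemeasurable).1 hindep'
  let Q : Set (E × (S → E)) := {z | ∀ b, dist (z.2 b) z.1 < R}
  have hQ : MeasurableSet Q := by
    simp only [Q, Set.ofPred_forall]
    exact MeasurableSet.iInter fun b => measurableSet_lt (by fun_prop) measurable_const
  have hev : {ω | ∀ b ∈ S, dist (X b ω) (X a ω) < R} =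
      (fun ω => (X a ω, fun i : S => X i ω)) ⁻¹' Q := by
    ext ω; simp [Q]
  rw [Measure.real, hev, ← Measure.map_apply ((hXm a).prodMk hYm) hQ, hmap,
    Measure.prod_apply hQ]
  have hpm := Measure.isProbabilityMeasure_map (μ := μ) (hXm a).aemeasurable
  refine ENNReal.toReal_le_of_le_ofReal (by positivity) ?_
  calc _ ≤ ∫⁻ _x, ENNReal.ofReal (B ^ S.card) ∂(μ.map (X a)) := by
        refine lintegral_mono fun x => ?_
        rw [Measure.map_apply hYm (measurable_prodMk_left hQ)]
        have h3 : (fun ω (i : S) => X i ω) ⁻¹' (Prod.mk x ⁻¹' Q) =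
            {ω | ∀ i ∈ S, X i ω ∈ Metric.ball x R} := by
          ext ω; simp [Q]
        rw [h3, ← ofReal_measureReal, measureReal_forall_mem hXm hXν hind measurableSet_ball]
        exact ENNReal.ofReal_le_ofReal (pow_le_pow_left₀ measureReal_nonneg (hB x) _)
    _ = _ := by simp

theorem measureReal_exists_card_dist_lt_le (hXm : ∀ i, Measurable (X i))
    (hXν : ∀ i, μ.map (X i) = ν) (hind : iIndepFun X μ) {R B : ℝ}
    (hB : ∀ x, ν.real (Metric.ball x R) ≤ B) (n m : ℕ) :
    μ.real {ω | ∃ a ∈ Finset.range n, ∃ S ∈ Finset.powersetCard m (Finset.range n),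
      a ∉ S ∧ ∀ b ∈ S, dist (X b ω) (X a ω) < R} ≤ n * (n.choose m * B ^ m) := by
  have hB0 : 0 ≤ B := by
    obtain ⟨ω⟩ := nonempty_of_isProbabilityMeasure μ
    exact measureReal_nonneg.trans (hB (X 0 ω))
  have hsub : {ω | ∃ a ∈ Finset.range n, ∃ S ∈ Finset.powersetCard m (Finset.range n),
      a ∉ S ∧ ∀ b ∈ S, dist (X b ω) (X a ω) < R} ⊆
      ⋃ a ∈ Finset.range n, ⋃ S ∈ Finset.powersetCard m (Finset.range n),
        {ω | a ∉ S ∧ ∀ b ∈ S, dist (X b ω) (X a ω) < R} := by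
    rintro ω ⟨a, ha, S, hS, h⟩
    simp only [Set.mem_iUnion]
    exact ⟨a, ha, S, hS, h⟩
  refine (measureReal_mono hsub (measure_ne_top _ _)).trans ((measureReal_biUnion_finset_le _ _).trans ?_)
  have h1 : ∀ a ∈ Finset.range n, μ.real (⋃ S ∈ Finset.powersetCard m (Finset.range n),
        {ω | a ∉ S ∧ ∀ b ∈ S, dist (X b ω) (X a ω) < R}) ≤ n.choose m * B ^ m := by
    intro a _
    refine (measureReal_biUnion_finset_le _ _).trans ?_
    calc _ ≤ ∑ _S ∈ Finset.powersetCard m (Finset.range n), B ^ m := by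
          refine Finset.sum_le_sum fun S hS => ?_
          by_cases haS : a ∈ S
          · simp only [haS, not_true_eq_false, false_and, Set.ofPred_false, measureReal_empty]
            positivity
          · simp only [haS, not_false_eq_true, true_and]
            rw [← (Finset.mem_powersetCard.1 hS).2]
            exact measureReal_forall_dist_lt_le hXm hXν hind hB haS
      _ = _ := by simp
  exact (Finset.sum_le_sum h1).trans_eq (by simp)

end FirstMoment

/-! ### Grid cubes charged by a bounded density. -/

section Cubes

theorem measurableSet_gridCube {d : ℕ} (s : ℝ) (z : Fin d → ℤ) : MeasurableSet (gridCube s z) := by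
  unfold gridCube
  rw [Set.ofPred_forall]
  refine MeasurableSet.iInter fun i => ?_
  have h : Measurable fun x : Fin d → ℝ => ⌊x i / s⌋ := Int.measurable_floor.comp (by fun_prop)
  exact h (measurableSet_singleton (z i))

theorem disjoint_gridCube {d : ℕ} (s : ℝ) :
    Pairwise fun z z' : Fin d → ℤ => Disjoint (gridCube s z) (gridCube s z') := by
  intro z z' hz
  refine Set.disjoint_left.2 fun x hx hx' => hz ?_
  funext i
  exact (hx i).symm.trans (hx' i)

variable {d : ℕ} {ν : Measure (Fin d → ℝ)} {M : ℝ}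

theorem withDensity_ball_le {f : (Fin d → ℝ) → ℝ} (hM : ∀ᵐ x, f x ≤ M)
    (hν : ν = volume.withDensity fun x => ENNReal.ofReal (f x)) (x : Fin d → ℝ) {s : ℝ}
    (hs : 0 < s) : ν.real (Metric.ball x s) ≤ max M 1 * (2 * s) ^ d := by
  rw [Measure.real, hν]
  refine ENNReal.toReal_le_of_le_ofReal (by positivity) ?_
  rw [withDensity_apply _ measurableSet_ball]
  calc _ ≤ ∫⁻ _y in Metric.ball x s, ENNReal.ofReal (max M 1) := by
        refine lintegral_mono_ae (ae_restrict_of_ae ?_)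
        filter_upwards [hM] with y hy
        exact ENNReal.ofReal_le_ofReal (hy.trans (le_max_left _ _))
    _ = _ := by
        rw [lintegral_const, Measure.restrict_apply_univ, Real.volume_pi_ball x hs,
          Fintype.card_fin, ENNReal.ofReal_mul (by positivity)]

variable [IsProbabilityMeasure ν]

theorem measureReal_gridCube_le (hball : ∀ x s, 0 < s → ν.real (Metric.ball x s) ≤ M * (2 * s) ^ d)
    (hM : 0 < M) {s : ℝ} (hs : 0 < s) (z : Fin d → ℤ) :
    ν.real (gridCube s z) ≤ M * (4 * s) ^ d := by
  rcases (gridCube s z).eq_empty_or_nonempty with h | ⟨x, hx⟩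
  · rw [h, measureReal_empty]
    positivity
  · have h4 : (4 : ℝ) * s = 2 * (2 * s) := by ring
    rw [h4]
    refine (measureReal_mono fun y hy => ?_).trans (hball x (2 * s) (by positivity))
    rw [Metric.mem_ball, dist_eq_norm]
    exact (norm_sub_le_of_mem_gridCube hs hy hx).trans_lt (by linarith)

theorem exists_half_le_measureReal_ball : ∃ R : ℝ, 0 < R ∧ 1 / 2 ≤ ν.real (Metric.ball 0 R) := by
  have hmono : Monotone fun n : ℕ => Metric.ball (0 : Fin d → ℝ) n := fun a b hab =>
    Metric.ball_subset_ball (by exact_mod_cast hab)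
  have h := tendsto_measure_iUnion_atTop (μ := ν) hmono
  rw [Metric.iUnion_ball_nat, measure_univ] at h
  have h2 : ∀ᶠ n : ℕ in atTop, (ENNReal.ofReal (1 / 2)) < ν (Metric.ball (0 : Fin d → ℝ) n) :=
    h.eventually_const_lt (by
      rw [← ENNReal.ofReal_one]
      exact (ENNReal.ofReal_lt_ofReal_iff one_pos).2 (by norm_num))
  obtain ⟨n, hn, hn0⟩ := (h2.and (eventually_gt_atTop 0)).exists
  refine ⟨n, by exact_mod_cast hn0, ?_⟩
  exact (ENNReal.ofReal_le_iff_le_toReal (measure_ne_top _ _)).1 hn.le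

/-- A bounded density charges, at every small scale `s`, a positive proportion of the grid cubes
of side `s` in a bounded region, each with mass of the order `s ^ d`. -/
theorem exists_finset_gridCube
    (hball : ∀ x s, 0 < s → ν.real (Metric.ball x s) ≤ M * (2 * s) ^ d) (hM : 0 < M) :
    ∃ c > 0, ∃ c₁ > 0, ∀ s : ℝ, 0 < s → s ≤ 1 → ∃ T : Finset (Fin d → ℤ),
      c₁ ≤ T.card * s ^ d ∧ ∀ z ∈ T, c * s ^ d ≤ ν.real (gridCube s z) := by
  classical
  obtain ⟨R, hR, hRν⟩ := exists_half_le_measureReal_ball (ν := ν)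
  -- c is chosen so that the light cubes meeting the index box carry mass at most 1/4 in total. As
  -- the box covers mass 1/2, the heavy cubes carry at least 1/4, and the upper bound on the mass of
  -- one cube then forces many of them.
  refine ⟨1 / (4 * (2 * R + 3) ^ d), by positivity, 1 / (4 * (M * 4 ^ d)), by positivity,
    fun s hs hs1 => ?_⟩
  set c : ℝ := 1 / (4 * (2 * R + 3) ^ d) with hc
  let K : ℤ := ⌈R / s⌉
  have hK0 : 0 ≤ K := Int.ceil_nonneg (by positivity)
  let Z : Finset (Fin d → ℤ) := Fintype.piFinset fun _ => Finset.Icc (-K) K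
  let T := Z.filter fun z => c * s ^ d ≤ ν.real (gridCube s z)
  refine ⟨T, ?_, fun z hz => (Finset.mem_filter.1 hz).2⟩
  have hcover : Metric.ball (0 : Fin d → ℝ) R ⊆ ⋃ z ∈ Z, gridCube s z := by
    intro x hx
    simp only [Set.mem_iUnion]
    refine ⟨fun i => ⌊x i / s⌋, ?_, fun i => rfl⟩
    refine Fintype.mem_piFinset.2 fun i => Finset.mem_Icc.2 ?_
    have hxi : |x i| < R := (norm_le_pi_norm x i).trans_lt (by simpa using hx)
    have h1 : |x i / s| ≤ K := by
      rw [abs_div, abs_of_pos hs]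
      exact (div_le_div_of_nonneg_right hxi.le hs.le).trans (Int.le_ceil _)
    obtain ⟨h2, h3⟩ := abs_le.1 h1
    refine ⟨Int.le_floor.2 (by push_cast; exact h2), ?_⟩
    exact_mod_cast (Int.floor_le (x i / s)).trans h3
  have hZ : (Z.card : ℝ) * s ^ d ≤ (2 * R + 3) ^ d := by
    have hcard : (Z.card : ℝ) = (2 * (K : ℝ) + 1) ^ d := by
      have : ((Finset.Icc (-K) K).card : ℝ) = 2 * (K : ℝ) + 1 := by
        rw [Int.card_Icc]
        have h : ((K + 1 - -K).toNat : ℤ) = 2 * K + 1 := by omega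
        exact_mod_cast congrArg (Int.cast : ℤ → ℝ) h
      rw [Fintype.card_piFinset, Finset.prod_const, Finset.card_univ, Fintype.card_fin,
        Nat.cast_pow, this]
    rw [hcard, ← mul_pow]
    have hK1 : (K : ℝ) ≤ R / s + 1 := (Int.ceil_lt_add_one _).le
    have hK2 : (0 : ℝ) ≤ K := by exact_mod_cast hK0
    refine pow_le_pow_left₀ (by positivity) ?_ d
    calc (2 * (K : ℝ) + 1) * s ≤ (2 * (R / s + 1) + 1) * s := by gcongr
      _ = 2 * R + 3 * s := by field_simp; ring
      _ ≤ 2 * R + 3 := by linarith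
  have hsum : (1 : ℝ) / 2 ≤ T.card * (M * (4 * s) ^ d) + Z.card * (c * s ^ d) := by
    calc (1 : ℝ) / 2 ≤ ν.real (Metric.ball 0 R) := hRν
      _ ≤ ν.real (⋃ z ∈ Z, gridCube s z) := measureReal_mono hcover (measure_ne_top _ _)
      _ ≤ ∑ z ∈ Z, ν.real (gridCube s z) := measureReal_biUnion_finset_le _ _
      _ ≤ ∑ z ∈ Z, ((if c * s ^ d ≤ ν.real (gridCube s z) then M * (4 * s) ^ d else 0) +
            c * s ^ d) := by
          refine Finset.sum_le_sum fun z _ => ?_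
          split_ifs with h
          · have := measureReal_gridCube_le hball hM hs z
            have : 0 ≤ c * s ^ d := by positivity
            linarith
          · linarith
      _ = _ := by
          rw [Finset.sum_add_distrib, ← Finset.sum_filter, Finset.sum_const, Finset.sum_const,
            nsmul_eq_mul, nsmul_eq_mul]
  have hbad : (Z.card : ℝ) * (c * s ^ d) ≤ 1 / 4 := by
    calc (Z.card : ℝ) * (c * s ^ d) = c * (Z.card * s ^ d) := by ring
      _ ≤ c * (2 * R + 3) ^ d := by gcongr
      _ = 1 / 4 := by rw [hc]; field_simp
  have h4 : (1 : ℝ) / 4 ≤ T.card * s ^ d * (M * 4 ^ d) := by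
    rw [mul_pow] at hsum
    linarith
  rw [div_le_iff₀ (by positivity)]
  linarith

end Cubes

/-! ### Growth of the cluster size and numerical estimates. -/

section Asymptotics

/-- The order of the largest local number of points when the mean local number is `a n`. -/
noncomputable def clusterSize (a : ℕ → ℝ) (n : ℕ) : ℝ :=
  Real.log n / Real.log (Real.log n / a n)

theorem eventually_rpow_neg_le {a : ℕ → ℝ} (ha : ∀ n, 0 ≤ a n)
    (hlow : ∀ ε : ℝ, 0 < ε → (fun n : ℕ => (n : ℝ) ^ (-ε)) =o[atTop] a) {ε : ℝ} (hε : 0 < ε) :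
    ∀ᶠ n : ℕ in atTop, (n : ℝ) ^ (-ε) ≤ a n := by
  filter_upwards [(hlow ε hε).bound one_pos] with n hn
  rwa [one_mul, Real.norm_of_nonneg (by positivity), Real.norm_of_nonneg (ha n)] at hn

theorem eventually_pos_of_isLittleO {a : ℕ → ℝ} (ha : ∀ n, 0 ≤ a n)
    (hlow : ∀ ε : ℝ, 0 < ε → (fun n : ℕ => (n : ℝ) ^ (-ε)) =o[atTop] a) :
    ∀ᶠ n : ℕ in atTop, 0 < a n := by
  filter_upwards [eventually_rpow_neg_le ha hlow one_pos, eventually_gt_atTop 0] with n hn hn0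
  have : (0 : ℝ) < n := by exact_mod_cast hn0
  exact (by positivity : (0 : ℝ) < (n : ℝ) ^ (-1 : ℝ)).trans_le hn

theorem eventually_le_mul_log {a : ℕ → ℝ} (ha : ∀ n, 0 ≤ a n)
    (hup : a =o[atTop] fun n : ℕ => Real.log n) {δ : ℝ} (hδ : 0 < δ) :
    ∀ᶠ n : ℕ in atTop, a n ≤ δ * Real.log n := by
  filter_upwards [hup.bound hδ] with n hn
  rwa [Real.norm_of_nonneg (ha n), Real.norm_of_nonneg (Real.log_natCast_nonneg n)] at hn

theorem eventually_log_le_mul_rpow {ε δ : ℝ} (hε : 0 < ε) (hδ : 0 < δ) :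
    ∀ᶠ x : ℝ in atTop, Real.log x ≤ δ * x ^ ε := by
  filter_upwards [(isLittleO_log_rpow_atTop hε).bound hδ, eventually_ge_atTop 1] with x hx h1
  rwa [Real.norm_of_nonneg (Real.log_nonneg h1), Real.norm_of_nonneg (by positivity)] at hx

theorem tendsto_log_div_atTop {a : ℕ → ℝ} (ha : ∀ n, 0 ≤ a n)
    (hlow : ∀ ε : ℝ, 0 < ε → (fun n : ℕ => (n : ℝ) ^ (-ε)) =o[atTop] a)
    (hup : a =o[atTop] fun n : ℕ => Real.log n) :
    Tendsto (fun n : ℕ => Real.log n / a n) atTop atTop := by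
  refine tendsto_atTop.2 fun K => ?_
  have hK : 0 < max K 1 := by positivity
  filter_upwards [eventually_pos_of_isLittleO ha hlow, eventually_le_mul_log ha hup (inv_pos.2 hK)]
    with n h1 h2
  refine (le_max_left K 1).trans ?_
  rw [le_div_iff₀ h1]
  rwa [← div_eq_inv_mul, le_div_iff₀' hK] at h2

/-- Since a n is eventually above every negative power of n, log (log n / a n) ≤ 2ε log n for each
ε, so the quotient exceeds 1/(2ε). -/
theorem tendsto_clusterSize {a : ℕ → ℝ} (ha : ∀ n, 0 ≤ a n)
    (hlow : ∀ ε : ℝ, 0 < ε → (fun n : ℕ => (n : ℝ) ^ (-ε)) =o[atTop] a)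
    (hup : a =o[atTop] fun n : ℕ => Real.log n) :
    Tendsto (clusterSize a) atTop atTop := by
  refine tendsto_atTop.2 fun K => ?_
  have hK : 0 < max K 1 := by positivity
  set ε : ℝ := 1 / (2 * max K 1) with hε
  have hε0 : 0 < ε := by positivity
  filter_upwards [eventually_rpow_neg_le ha hlow hε0, eventually_gt_atTop 1,
    tendsto_natCast_atTop_atTop.eventually (eventually_log_le_mul_rpow hε0 one_pos),
    (tendsto_log_div_atTop ha hlow hup).eventually_gt_atTop 1] with n h1 h2 h3 h4
  refine (le_max_left K 1).trans ?_
  have hn : (0 : ℝ) < n := by exact_mod_cast zero_lt_one.trans h2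
  have hlog : 0 < Real.log n := Real.log_pos (by exact_mod_cast h2)
  have hane : 0 < (n : ℝ) ^ (-ε) := by positivity
  unfold clusterSize
  rw [le_div_iff₀ (Real.log_pos h4)]
  have hL : Real.log n / a n ≤ (n : ℝ) ^ (2 * ε) := by
    calc Real.log n / a n ≤ (1 * (n : ℝ) ^ ε) / (n : ℝ) ^ (-ε) := by gcongr
      _ = (n : ℝ) ^ (2 * ε) := by
        rw [one_mul, ← Real.rpow_sub hn]
        congr 1
        ring
  have h5 := Real.log_le_log (by linarith) hL
  rw [Real.log_rpow hn] at h5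
  calc max K 1 * Real.log (Real.log n / a n) ≤ max K 1 * (2 * ε * Real.log n) := by gcongr
    _ = Real.log n := by rw [hε]; field_simp

theorem eventually_clusterSize_le_mul_log {a : ℕ → ℝ} (ha : ∀ n, 0 ≤ a n)
    (hlow : ∀ ε : ℝ, 0 < ε → (fun n : ℕ => (n : ℝ) ^ (-ε)) =o[atTop] a)
    (hup : a =o[atTop] fun n : ℕ => Real.log n) {δ : ℝ} (hδ : 0 < δ) :
    ∀ᶠ n : ℕ in atTop, clusterSize a n ≤ δ * Real.log n := by
  filter_upwards [(Real.tendsto_log_atTop.comp (tendsto_log_div_atTop ha hlow hup)).eventually_ge_atTop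
    δ⁻¹] with n hn
  have hn' : δ⁻¹ ≤ Real.log (Real.log n / a n) := hn
  unfold clusterSize
  rw [div_le_iff₀ ((inv_pos.2 hδ).trans_le hn')]
  have h1 : 1 ≤ δ * Real.log (Real.log n / a n) := by
    rwa [inv_le_iff_one_le_mul₀' hδ] at hn'
  nlinarith [Real.log_natCast_nonneg n]

/-- The first-moment bound is polynomially small just above `clusterSize`. -/
theorem eventually_mul_pow_le {a : ℕ → ℝ} (ha : ∀ n, 0 ≤ a n)
    (hlow : ∀ ε : ℝ, 0 < ε → (fun n : ℕ => (n : ℝ) ^ (-ε)) =o[atTop] a)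
    (hup : a =o[atTop] fun n : ℕ => Real.log n) {ε C : ℝ} (hε : 0 < ε) (hε1 : ε ≤ 1)
    (hC : 0 < C) :
    ∀ᶠ n : ℕ in atTop, ∀ m : ℕ, (1 + ε) * clusterSize a n ≤ m →
      n * (C * a n / m) ^ m ≤ (n : ℝ) ^ (-(ε / 2)) := by
  have hLt := tendsto_log_div_atTop ha hlow hup
  filter_upwards [eventually_pos_of_isLittleO ha hlow, eventually_gt_atTop 1,
    hLt.eventually (eventually_log_le_mul_rpow (ε := ε / 4) (by positivity) (inv_pos.2 hC)),
    hLt.eventually_gt_atTop 1] with n h1 h2 h3 h4 m hm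
  have hn : (0 : ℝ) < n := by exact_mod_cast zero_lt_one.trans h2
  have hlog : 0 < Real.log n := Real.log_pos (by exact_mod_cast h2)
  set L := Real.log n / a n with hL
  have hL0 : 0 < L := by linarith
  have hlogL : 0 < Real.log L := Real.log_pos h4
  have hk : clusterSize a n = Real.log n / Real.log L := rfl
  have hk0 : 0 < clusterSize a n := by rw [hk]; positivity
  have hkm : clusterSize a n ≤ m := by nlinarith
  have hm0 : (0 : ℝ) < m := hk0.trans_le hkm
  -- At m ≥ `clusterSize a n` the base is at most C log L / L; the slack L^(ε/4) absorbs both C and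
  -- log L.
  have hbase : C * a n / m ≤ L ^ (ε / 4 - 1) := by
    calc C * a n / m ≤ C * a n / clusterSize a n := by gcongr
      _ = C * Real.log L / L := by rw [hk, hL]; field_simp
      _ ≤ C * (C⁻¹ * L ^ (ε / 4)) / L := by gcongr
      _ = L ^ (ε / 4 - 1) := by rw [Real.rpow_sub_one hL0.ne']; field_simp
  have hpow : (C * a n / m) ^ m ≤ (n : ℝ) ^ (-(1 + ε / 2)) := by
    calc (C * a n / m) ^ m ≤ (L ^ (ε / 4 - 1)) ^ m := by gcongr
      _ = Real.exp (Real.log L * ((ε / 4 - 1) * m)) := by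
        rw [← Real.rpow_natCast, ← Real.rpow_mul hL0.le, Real.rpow_def_of_pos hL0]
      _ ≤ Real.exp (Real.log n * (-(1 + ε / 2))) := by
        refine Real.exp_le_exp.2 ?_
        have h5 : (1 + ε) * Real.log n ≤ m * Real.log L := by
          rw [hk, ← mul_div_assoc, div_le_iff₀ hlogL] at hm
          exact hm
        have h6 : (1 - ε / 4) * ((1 + ε) * Real.log n) ≤ (1 - ε / 4) * (m * Real.log L) :=
          mul_le_mul_of_nonneg_left h5 (by linarith)
        -- (1 - ε/4)(1 + ε) ≥ 1 + ε/2 is where ε ≤ 1 enters.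
        have h7 : (1 + ε / 2) * Real.log n ≤ (1 - ε / 4) * ((1 + ε) * Real.log n) := by
          rw [← mul_assoc]
          refine mul_le_mul_of_nonneg_right ?_ hlog.le
          nlinarith
        linarith
      _ = (n : ℝ) ^ (-(1 + ε / 2)) := by rw [Real.rpow_def_of_pos hn]
  calc n * (C * a n / m) ^ m ≤ n * (n : ℝ) ^ (-(1 + ε / 2)) := by gcongr
    _ = (n : ℝ) ^ (1 + -(1 + ε / 2)) := by rw [Real.rpow_add hn, Real.rpow_one]
    _ = _ := by congr 1; ring

/-- The probability of a cluster just below `clusterSize` in a given cell is not too small. -/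
theorem eventually_le_pow_mul_exp {a : ℕ → ℝ} (ha : ∀ n, 0 ≤ a n)
    (hlow : ∀ ε : ℝ, 0 < ε → (fun n : ℕ => (n : ℝ) ^ (-ε)) =o[atTop] a)
    (hup : a =o[atTop] fun n : ℕ => Real.log n) {ε c C : ℝ} (hε : 0 < ε)
    (hc : 0 < c) (hC : 0 < C) :
    ∀ᶠ n : ℕ in atTop, ∀ m : ℕ, 1 ≤ m → m ≤ (1 - ε) * clusterSize a n →
      (n : ℝ) ^ (-1 + ε / 2) ≤ (c * a n / m) ^ m * Real.exp (-(C * a n)) := by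
  have hLt := tendsto_log_div_atTop ha hlow hup
  filter_upwards [eventually_pos_of_isLittleO ha hlow, eventually_gt_atTop 1,
    (Real.tendsto_log_atTop.comp hLt).eventually_ge_atTop c⁻¹,
    hLt.eventually_gt_atTop 1,
    eventually_le_mul_log ha hup (δ := ε / 2 / C) (by positivity)] with n h1 h2 h3 h4 h5 m hm1 hm
  have hn : (0 : ℝ) < n := by exact_mod_cast zero_lt_one.trans h2
  have hlog : 0 < Real.log n := Real.log_pos (by exact_mod_cast h2)
  set L := Real.log n / a n with hL
  have hL0 : 0 < L := by linarith
  have h3' : c⁻¹ ≤ Real.log L := h3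
  have hlogL : 0 < Real.log L := Real.log_pos h4
  have hk : clusterSize a n = Real.log n / Real.log L := rfl
  have hk0 : 0 < clusterSize a n := by rw [hk]; positivity
  have hm0 : (0 : ℝ) < m := by exact_mod_cast hm1
  have hmk : (m : ℝ) ≤ clusterSize a n := by nlinarith
  have hbase : L⁻¹ ≤ c * a n / m := by
    calc L⁻¹ = c * c⁻¹ / L := by rw [mul_inv_cancel₀ hc.ne', one_div]
      _ ≤ c * Real.log L / L := by gcongr
      _ = c * a n / clusterSize a n := by rw [hk, hL]; field_simp
      _ ≤ c * a n / m := by gcongr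
  have h6 : m * Real.log L ≤ (1 - ε) * Real.log n := by
    rw [hk, ← mul_div_assoc, le_div_iff₀ hlogL] at hm
    exact hm
  have h7 : C * a n ≤ ε / 2 * Real.log n := by
    calc C * a n ≤ C * (ε / 2 / C * Real.log n) := by gcongr
      _ = _ := by field_simp
  calc (n : ℝ) ^ (-1 + ε / 2) = Real.exp (Real.log n * (-1 + ε / 2)) := Real.rpow_def_of_pos hn _
    _ ≤ Real.exp (m * -Real.log L + -(C * a n)) := Real.exp_le_exp.2 (by linarith)
    _ = (L⁻¹) ^ m * Real.exp (-(C * a n)) := by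
      rw [Real.exp_add, Real.exp_nat_mul, Real.exp_neg (Real.log L), Real.exp_log hL0]
    _ ≤ _ := by gcongr

theorem eventually_exp_neg_rpow_le {δ : ℝ} (hδ : 0 < δ) :
    ∀ᶠ n : ℕ in atTop, Real.exp (-((n : ℝ) ^ δ / 2)) ≤ (n : ℝ) ^ (-2 : ℝ) := by
  filter_upwards [tendsto_natCast_atTop_atTop.eventually
    (eventually_log_le_mul_rpow hδ (by norm_num : (0 : ℝ) < 1 / 4)), eventually_gt_atTop 0]
    with n h1 h2
  have hn : (0 : ℝ) < n := by exact_mod_cast h2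
  rw [Real.rpow_def_of_pos hn (-2)]
  exact Real.exp_le_exp.2 (by linarith)

/-- The numerical conditions under which some of `⌊n ^ (1 - ε / 4)⌋₊` cells holds a cluster of
size `⌊(1 - ε) * clusterSize a n⌋₊`, up to probability `n ^ (-2)`. -/
theorem eventually_occupancy_conditions {a : ℕ → ℝ} (ha : ∀ n, 0 ≤ a n)
    (hlow : ∀ ε : ℝ, 0 < ε → (fun n : ℕ => (n : ℝ) ^ (-ε)) =o[atTop] a)
    (hup : a =o[atTop] fun n : ℕ => Real.log n) {ε c c₁ : ℝ} (hε : 0 < ε) (hε1 : ε < 1)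
    (hc : 0 < c) (hc₁ : 0 < c₁) :
    ∀ᶠ n : ℕ in atTop, ∃ m J : ℕ, m = ⌊(1 - ε) * clusterSize a n⌋₊ ∧ 1 ≤ m ∧
      2 * (m * J) ≤ n ∧ 4 * m ≤ n ∧ J * a n ≤ c₁ * n ∧ c * a n ≤ n / 2 ∧
      Real.exp (-(((c / 4 * a n / m) ^ m * Real.exp (-(2 * c * a n))) * J)) ≤
        (n : ℝ) ^ (-2 : ℝ) := by
  have hk := tendsto_clusterSize ha hlow hup
  have he4 : 0 < ε / 4 := by positivity
  have hcast : Tendsto (fun n : ℕ => (n : ℝ)) atTop atTop := tendsto_natCast_atTop_atTop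
  filter_upwards [eventually_gt_atTop 1, hk.eventually_ge_atTop (1 / (1 - ε)),
    eventually_clusterSize_le_mul_log ha hlow hup one_pos,
    hcast.eventually (eventually_log_le_mul_rpow he4 (by norm_num : (0 : ℝ) < 1 / 4)),
    hcast.eventually (eventually_log_le_mul_rpow he4 hc₁),
    hcast.eventually (eventually_log_le_mul_rpow one_pos (by positivity : 0 < 1 / (2 * c))),
    eventually_le_mul_log ha hup one_pos,
    eventually_le_pow_mul_exp ha hlow hup hε (by positivity : 0 < c / 4)
      (by positivity : 0 < 2 * c),
    ((tendsto_rpow_atTop (by linarith : 0 < 1 - ε / 4)).comp hcast).eventually_ge_atTop 2,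
    eventually_exp_neg_rpow_le he4] with n h1 h2 h3 h4 h5 h6 h7 h8 h9 h10
  have hn : (0 : ℝ) < n := by exact_mod_cast zero_lt_one.trans h1
  have h9' : 2 ≤ (n : ℝ) ^ (1 - ε / 4) := h9
  have hε' : 0 < 1 - ε := by linarith
  have hk1 : 1 ≤ (1 - ε) * clusterSize a n := by rwa [div_le_iff₀' hε'] at h2
  set m := ⌊(1 - ε) * clusterSize a n⌋₊ with hm
  -- This exponent balances two needs: J times the success probability n^(-1+ε/2) is still of order
  -- n^(ε/4), while m J and J a n, with m and a n at most log n, remain within fixed multiples of n.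
  set J := ⌊(n : ℝ) ^ (1 - ε / 4)⌋₊ with hJ
  have hmle : (m : ℝ) ≤ (1 - ε) * clusterSize a n := Nat.floor_le (by linarith)
  have hm1 : 1 ≤ m := Nat.le_floor (by simpa using hk1)
  have hJle : (J : ℝ) ≤ (n : ℝ) ^ (1 - ε / 4) := Nat.floor_le (by positivity)
  have hJge : (n : ℝ) ^ (1 - ε / 4) / 2 ≤ J := by
    have := Nat.lt_floor_add_one ((n : ℝ) ^ (1 - ε / 4))
    rw [← hJ] at this
    linarith
  have hJ1 : 1 ≤ J := by
    have : (1 : ℝ) ≤ J := by linarith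
    exact_mod_cast this
  have hmlog : (m : ℝ) ≤ Real.log n := by
    have hk0 : 0 ≤ clusterSize a n := by nlinarith
    nlinarith
  have hsplit : (n : ℝ) ^ (ε / 4) * (n : ℝ) ^ (1 - ε / 4) = n := by
    rw [← Real.rpow_add hn, add_sub_cancel, Real.rpow_one]
  have hmJ : 4 * ((m : ℝ) * J) ≤ n := by
    calc 4 * ((m : ℝ) * J) ≤ 4 * ((1 / 4 * (n : ℝ) ^ (ε / 4)) * (n : ℝ) ^ (1 - ε / 4)) := by
          gcongr
          exact hmlog.trans h4
      _ = n := by linear_combination hsplit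
  have hmJ' : 4 * (m * J) ≤ n := by exact_mod_cast hmJ
  refine ⟨m, J, rfl, hm1, by omega, ?_, ?_, ?_, ?_⟩
  · exact (Nat.mul_le_mul_left 4 (Nat.le_mul_of_pos_right m hJ1)).trans hmJ'
  · calc J * a n ≤ (n : ℝ) ^ (1 - ε / 4) * (c₁ * (n : ℝ) ^ (ε / 4)) :=
          mul_le_mul hJle (by linarith) (ha n) (by positivity)
      _ = c₁ * n := by linear_combination c₁ * hsplit
  · calc c * a n ≤ c * (1 / (2 * c) * (n : ℝ) ^ (1 : ℝ)) := by
          gcongr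
          linarith
      _ = n / 2 := by rw [Real.rpow_one]; field_simp
  · refine (Real.exp_le_exp.2 (neg_le_neg ?_)).trans h10
    calc (n : ℝ) ^ (ε / 4) / 2 = (n : ℝ) ^ (-1 + ε / 2) * ((n : ℝ) ^ (1 - ε / 4) / 2) := by
          rw [← mul_div_assoc, ← Real.rpow_add hn]
          congr 2
          ring
      _ ≤ _ := mul_le_mul (h8 m hm1 hmle) hJge (by positivity) (by have := ha n; positivity)

end Asymptotics

/-! ### Almost sure lower bound by Borel–Cantelli. -/

section AlmostSure

theorem ae_eventually_notMem_of_eventually_le {Ω : Type*} [MeasurableSpace Ω] {μ : Measure Ω}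
    [IsProbabilityMeasure μ] {s : ℕ → Set Ω} {g : ℕ → ℝ} (hg : Summable g)
    (h : ∀ᶠ n in atTop, μ.real (s n) ≤ g n) : ∀ᵐ ω ∂μ, ∀ᶠ n in atTop, ω ∉ s n := by
  refine ae_eventually_notMem ?_
  have hs : Summable fun n => μ.real (s n) := by
    refine Summable.of_norm_bounded_eventually_nat hg ?_
    filter_upwards [h] with n hn
    rwa [Real.norm_of_nonneg measureReal_nonneg]
  have h2 : (fun n => ENNReal.ofReal (μ.real (s n))) = fun n => μ (s n) :=
    funext fun n => ofReal_measureReal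
  exact h2 ▸ hs.tsum_ofReal_ne_top

/-- Bounds a single binomial term from below, uniformly for N between n/2 and n, the range of sample
sizes left while cells are revealed. It uses m! ≤ m^m and 1 - q ≥ exp(-2q) for q ≤ 1/2. -/
theorem pow_mul_exp_le_choose_mul {n N m : ℕ} {q : ℝ} (hnN : n ≤ 2 * N) (hNn : N ≤ n)
    (hm1 : 1 ≤ m) (hm : 4 * m ≤ n) (hq0 : 0 ≤ q) (hq : q ≤ 1 / 2) :
    (n * q / (4 * m)) ^ m * Real.exp (-(2 * (n * q))) ≤
      (N.choose m : ℝ) * q ^ m * (1 - q) ^ (N - m) := by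
  have hm0 : (0 : ℝ) < m := by exact_mod_cast hm1
  have h1 : ((n : ℝ) / (4 * m)) ^ m ≤ N.choose m := by
    calc ((n : ℝ) / (4 * m)) ^ m = ((n : ℝ) / 4) ^ m / (m : ℝ) ^ m := by
          rw [← div_pow, div_div]
      _ ≤ ((N + 1 - m : ℕ) : ℝ) ^ m / (m.factorial : ℝ) := by
          have hb : (n : ℝ) / 4 ≤ ((N + 1 - m : ℕ) : ℝ) := by
            rw [div_le_iff₀ (by norm_num)]
            have : n ≤ (N + 1 - m) * 4 := by omega
            exact_mod_cast this
          have hf : (m.factorial : ℝ) ≤ (m : ℝ) ^ m := by exact_mod_cast Nat.factorial_le_pow m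
          have hf0 : (0 : ℝ) < m.factorial := by exact_mod_cast Nat.factorial_pos m
          gcongr
      _ ≤ N.choose m := Nat.pow_le_choose m N
  have hq1 : 0 < 1 - q := by linarith
  have h2 : Real.exp (-(2 * q)) ≤ 1 - q := by
    have h3 : 1 + 2 * q ≤ Real.exp (2 * q) := by
      have := Real.add_one_le_exp (2 * q)
      linarith
    rw [Real.exp_neg]
    have h4 : 0 < 1 + 2 * q := by linarith
    refine (inv_anti₀ h4 h3).trans ?_
    rw [inv_le_iff_one_le_mul₀ h4]
    nlinarith
  have h5 : Real.exp (-(2 * (n * q))) ≤ (1 - q) ^ (N - m) := by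
    calc Real.exp (-(2 * (n * q))) = Real.exp (-(2 * q)) ^ n := by
          rw [← Real.exp_nat_mul]
          congr 1
          ring
      _ ≤ (1 - q) ^ n := by gcongr
      _ ≤ (1 - q) ^ (N - m) := pow_le_pow_of_le_one hq1.le (by linarith) (by omega)
  calc (n * q / (4 * m)) ^ m * Real.exp (-(2 * (n * q)))
      = (n / (4 * m)) ^ m * q ^ m * Real.exp (-(2 * (n * q))) := by
        rw [← mul_pow]
        congr 2
        ring
    _ ≤ _ := by gcongr

variable {Ω : Type*} [MeasurableSpace Ω] {μ : Measure Ω} [IsProbabilityMeasure μ]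
  {d : ℕ} {p : ℝ≥0∞} {ν : Measure (Fin d → ℝ)} {X : ℕ → Ω → Fin d → ℝ} {r : ℕ → ℝ} {M : ℝ}

theorem ae_eventually_floor_clusterSize_le_chromaticNumber (hp : 1 ≤ p)
    (hXm : ∀ i, Measurable (X i)) (hXν : ∀ i, μ.map (X i) = ν) (hind : iIndepFun X μ)
    (hball : ∀ x s, 0 < s → ν.real (Metric.ball x s) ≤ M * (2 * s) ^ d) (hM : 0 < M)
    (hr0 : ∀ᶠ n in atTop, 0 < r n) (hr1 : ∀ᶠ n in atTop, r n ≤ 1)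
    (ha : ∀ n : ℕ, 0 ≤ (n : ℝ) * r n ^ d)
    (hlow : ∀ ε : ℝ, 0 < ε →
      (fun n : ℕ => (n : ℝ) ^ (-ε)) =o[atTop] fun n : ℕ => (n : ℝ) * r n ^ d)
    (hup : (fun n : ℕ => (n : ℝ) * r n ^ d) =o[atTop] fun n : ℕ => Real.log (n : ℝ))
    {ε : ℝ} (hε : 0 < ε) (hε1 : ε < 1) :
    ∀ᵐ ω ∂μ, ∀ᶠ n : ℕ in atTop,
      (⌊(1 - ε) * clusterSize (fun n : ℕ => (n : ℝ) * r n ^ d) n⌋₊ : ℕ∞) ≤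
        (randomGeometricGraph p X r n ω).chromaticNumber := by
  classical
  have hν : IsProbabilityMeasure ν := hXν 0 ▸ Measure.isProbabilityMeasure_map (hXm 0).aemeasurable
  set a : ℕ → ℝ := fun n : ℕ => (n : ℝ) * r n ^ d with ha_def
  obtain ⟨c, hc, c₁, hc₁, hcubes⟩ := exists_finset_gridCube hball hM
  have hd : (0 : ℝ) < ((d : ℝ) + 1) ^ d := by positivity
  let bad : ℕ → Set Ω := fun n => {ω | ∀ z : Fin d → ℤ, ∑ i ∈ Finset.range n,
    (gridCube (r n / (d + 1)) z).indicator (fun _ => (1 : ℕ)) (X i ω) <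
      ⌊(1 - ε) * clusterSize a n⌋₊}
  have hbad : ∀ᶠ n : ℕ in atTop, μ.real (bad n) ≤ (n : ℝ) ^ (-2 : ℝ) := by
    filter_upwards [eventually_occupancy_conditions ha hlow hup hε hε1
      (div_pos hc hd) (mul_pos hc₁ hd), hr0, hr1, eventually_gt_atTop 0]
      with n ⟨m, J, hm, hm1, hmJ, hm4, hJ, hq2, hexp⟩ hrn hrn1 hn
    have hn0 : (0 : ℝ) < n := by exact_mod_cast hn
    have hs : 0 < r n / (d + 1) := by positivity
    obtain ⟨T, hT, hTν⟩ := hcubes (r n / (d + 1)) hs (by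
      rw [div_le_one (by positivity)]
      exact hrn1.trans (by linarith [Nat.cast_nonneg (α := ℝ) d]))
    set q : ℝ := c * (r n / (d + 1)) ^ d with hq
    have hq0 : 0 < q := by positivity
    have hnq : n * q = c / ((d : ℝ) + 1) ^ d * a n := by
      simp only [hq, ha_def, div_pow]
      ring
    have hqhalf : q ≤ 1 / 2 := by
      rw [← hnq] at hq2
      nlinarith
    have hJT : J ≤ T.card := by
      have h1 : (J : ℝ) * (r n / (d + 1)) ^ d ≤ T.card * (r n / (d + 1)) ^ d := by
        refine le_trans ?_ hT
        rw [div_pow, ← mul_div_assoc, div_le_iff₀ hd]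
        refine le_of_mul_le_mul_left ?_ hn0
        calc (n : ℝ) * (J * r n ^ d) = J * a n := by simp only [ha_def]; ring
          _ ≤ _ := hJ
          _ = _ := by ring
      exact_mod_cast le_of_mul_le_mul_right h1 (by positivity)
    obtain ⟨T', hT'T, hT'⟩ := Finset.exists_subset_card_eq hJT
    set β : ℝ := (n * q / (4 * m)) ^ m * Real.exp (-(2 * (n * q))) with hβ
    -- Revealing J cells uses at most m J ≤ n/2 points. The tail is largest at t = q, and it misses
    -- at least the term of index m, which is at least β.
    have hγ : ∀ N, n - m * J ≤ N → N ≤ n → ∀ t, q ≤ t → t ≤ 1 → binomialLt N m t ≤ 1 - β := by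
      intro N hN hNn t hqt ht
      have h1 := pow_mul_exp_le_choose_mul (n := n) (N := N) (by omega) hNn hm1 hm4 hq0.le hqhalf
      have h2 := binomialLt_le_one_sub (N := N) (m := m) (by omega) hq0.le (hqt.trans ht)
      have h3 := binomialLt_antitone N m hq0.le hqt ht
      linarith
    have hγ0 : 0 ≤ 1 - β := by
      refine le_trans ?_ (hγ n (by omega) le_rfl q le_rfl (by linarith))
      have : 0 ≤ 1 - q := by linarith
      exact Finset.sum_nonneg fun s _ => by positivity
    have hmain := measureReal_forall_count_lt_le hXm hXν hind
      (fun z => measurableSet_gridCube (r n / (d + 1)) z) (disjoint_gridCube (r n / (d + 1)))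
      hq0 hγ0 hγ T' (fun z hz => hTν z (hT'T hz)) Set.univ MeasurableSet.univ
      (fun _ _ => Set.subset_univ _) (Finset.range n)
      (by rw [hT', Finset.card_range]; omega) (by rw [Finset.card_range])
    rw [probReal_univ, one_pow, one_mul, hT'] at hmain
    have hβ' : β = (c / ((d : ℝ) + 1) ^ d / 4 * a n / m) ^ m *
        Real.exp (-(2 * (c / ((d : ℝ) + 1) ^ d) * a n)) := by
      rw [hβ, hnq]
      congr 2 <;> ring
    calc μ.real (bad n) ≤ (1 - β) ^ J := by
          refine le_trans (measureReal_mono (fun ω hω => ?_) (measure_ne_top _ _)) hmain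
          exact ⟨fun _ _ => Set.mem_univ _, fun z _ => hm ▸ hω z⟩
      _ ≤ Real.exp (-β) ^ J := by
        gcongr
        linarith [Real.add_one_le_exp (-β)]
      _ = Real.exp (-(β * J)) := by
        rw [← Real.exp_nat_mul]
        congr 1
        ring
      _ ≤ _ := by
        rw [hβ']
        exact hexp
  filter_upwards [ae_eventually_notMem_of_eventually_le
    (Real.summable_nat_rpow.2 (by norm_num)) hbad] with ω hω
  filter_upwards [hω, hr0] with n hn hrn
  simp only [bad, Set.mem_ofPred_eq, not_forall, not_lt] at hn
  obtain ⟨z, hz⟩ := hn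
  let S : Finset (Fin n) := Finset.univ.filter fun i => X i ω ∈ gridCube (r n / (d + 1)) z
  have hS := card_le_chromaticNumber_geometricGraph hp (fun i : Fin n => X i ω) hrn z S
    fun i hi => (Finset.mem_filter.1 hi).2
  refine le_trans ?_ hS
  rw [Finset.sum_range fun i =>
    (gridCube (r n / (d + 1)) z).indicator (fun _ => (1 : ℕ)) (X i ω)] at hz
  have hcard : S.card = ∑ i : Fin n,
      (gridCube (r n / (d + 1)) z).indicator (fun _ => (1 : ℕ)) (X i ω) := by
    simp only [S, Finset.card_filter, Set.indicator_apply]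
  rw [← hcard] at hz
  exact_mod_cast hz

end AlmostSure

/-! ### Almost sure upper bound along dyadic scales. -/

section UpperBound

theorem choose_le_exp_mul_div_pow (n m : ℕ) :
    (n.choose m : ℝ) ≤ (Real.exp 1 * n / m) ^ m := by
  rcases Nat.eq_zero_or_pos m with rfl | hm
  · simp
  have hm0 : (0 : ℝ) < m := by exact_mod_cast hm
  have hf : (0 : ℝ) < m.factorial := by exact_mod_cast Nat.factorial_pos m
  have h1 : (m : ℝ) ^ m / m.factorial ≤ Real.exp 1 ^ m := by
    have := Real.pow_div_factorial_le_exp (m : ℝ) hm0.le m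
    rwa [← Real.exp_nat_mul, mul_one]
  calc (n.choose m : ℝ) ≤ (n : ℝ) ^ m / m.factorial := Nat.choose_le_pow_div m n
    _ = (n / m : ℝ) ^ m * ((m : ℝ) ^ m / m.factorial) := by
      rw [div_pow]
      field_simp
    _ ≤ (n / m : ℝ) ^ m * Real.exp 1 ^ m := by gcongr
    _ = _ := by rw [← mul_pow]; congr 1; ring

/-- Absence of crowding passes from a larger sample to a smaller one, so one dyadic sample size
controls all n below it. -/
theorem ncard_lt_of_forall_not {E : Type*} [PseudoMetricSpace E] (x : ℕ → E) {n n' m : ℕ}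
    (hn : n ≤ n') {R : ℝ}
    (h : ¬ ∃ a ∈ Finset.range n', ∃ S ∈ Finset.powersetCard m (Finset.range n'),
      a ∉ S ∧ ∀ b ∈ S, dist (x b) (x a) < R) (v : Fin n) :
    Set.ncard {u : Fin n | u ≠ v ∧ dist (x u) (x v) < R} < m := by
  by_contra hcon
  rw [not_lt] at hcon
  obtain ⟨t, ht, htm⟩ := Set.exists_subset_card_eq hcon
  refine h ⟨v, Finset.mem_range.2 (v.2.trans_le hn),
    t.toFinite.toFinset.map Fin.valEmbedding, ?_, ?_, ?_⟩
  · refine Finset.mem_powersetCard.2 ⟨fun b hb => ?_, ?_⟩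
    · obtain ⟨u, -, rfl⟩ := Finset.mem_map.1 hb
      exact Finset.mem_range.2 (u.2.trans_le hn)
    · rw [Finset.card_map, ← Set.ncard_eq_toFinset_card t, htm]
  · intro hv
    obtain ⟨u, hu, huv⟩ := Finset.mem_map.1 hv
    exact (ht ((Set.Finite.mem_toFinset _).1 hu)).1 (Fin.ext huv)
  · intro b hb
    obtain ⟨u, hu, rfl⟩ := Finset.mem_map.1 hb
    exact (ht ((Set.Finite.mem_toFinset _).1 hu)).2

variable {Ω : Type*} [MeasurableSpace Ω] {μ : Measure Ω} [IsProbabilityMeasure μ]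
  {d : ℕ} {p : ℝ≥0∞} {ν : Measure (Fin d → ℝ)} {X : ℕ → Ω → Fin d → ℝ} {r : ℕ → ℝ} {M : ℝ}

/-- Some point among the first `n` has at least `m` others within distance `R`. -/
def crowdedEvent (X : ℕ → Ω → Fin d → ℝ) (n m : ℕ) (R : ℝ) : Set Ω :=
  {ω | ∃ a ∈ Finset.range n, ∃ S ∈ Finset.powersetCard m (Finset.range n),
    a ∉ S ∧ ∀ b ∈ S, dist (X b ω) (X a ω) < R}

/-- First-moment bounds, uniform over dyadic numbers of points and dyadic radii. -/
theorem ae_eventually_forall_dyadic_notMem_crowdedEvent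
    (hXm : ∀ i, Measurable (X i)) (hXν : ∀ i, μ.map (X i) = ν) (hind : iIndepFun X μ)
    (hball : ∀ x s, 0 < s → ν.real (Metric.ball x s) ≤ M * (2 * s) ^ d) {C : ℝ} (hC : 0 < C)
    {ε : ℝ} (hε : 0 < ε) :
    ∀ᵐ ω ∂μ, ∀ᶠ j : ℕ in atTop, ∀ i < 2 * j + 2, ∀ m ≤ j,
      2 ^ (j + 1) * ((2 ^ (j + 1) : ℕ).choose m * (M * (2 * (C * (1 / 2) ^ i)) ^ d) ^ m) ≤
        2 * ((2 : ℝ) ^ (-ε)) ^ j →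
      ω ∉ crowdedEvent X (2 ^ (j + 1)) m (C * (1 / 2) ^ i) := by
  classical
  -- Building the numerical condition into the event makes every term small: pairs (i, m) violating
  -- it contribute the empty set.
  let cond : ℕ → ℕ → ℕ → Prop := fun j i m =>
    2 ^ (j + 1) * ((2 ^ (j + 1) : ℕ).choose m * (M * (2 * (C * (1 / 2) ^ i)) ^ d) ^ m) ≤
        2 * ((2 : ℝ) ^ (-ε)) ^ j
  let bad : ℕ → Set Ω := fun j => ⋃ i ∈ Finset.range (2 * j + 2), ⋃ m ∈ Finset.range (j + 1),
    {ω | cond j i m ∧ ω ∈ crowdedEvent X (2 ^ (j + 1)) m (C * (1 / 2) ^ i)}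
  have hq : ‖(2 : ℝ) ^ (-ε)‖ < 1 := by
    rw [Real.norm_of_nonneg (by positivity)]
    exact Real.rpow_lt_one_of_one_lt_of_neg one_lt_two (neg_neg_of_pos hε)
  -- The summand is 4(j+1)²·2^(-εj): there are (2j+2)(j+1) pairs (i, m), each contributing at most
  -- 2·2^(-εj).
  have hsum : Summable fun j : ℕ =>
      4 * ((j : ℝ) ^ 2 * ((2 : ℝ) ^ (-ε)) ^ j) + 8 * ((j : ℝ) ^ 1 * ((2 : ℝ) ^ (-ε)) ^ j) +
        4 * ((j : ℝ) ^ 0 * ((2 : ℝ) ^ (-ε)) ^ j) :=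
    (((summable_pow_mul_geometric_of_norm_lt_one 2 hq).mul_left 4).add
      ((summable_pow_mul_geometric_of_norm_lt_one 1 hq).mul_left 8)).add
      ((summable_pow_mul_geometric_of_norm_lt_one 0 hq).mul_left 4)
  have hbad : ∀ j, μ.real (bad j) ≤
      4 * ((j : ℝ) ^ 2 * ((2 : ℝ) ^ (-ε)) ^ j) + 8 * ((j : ℝ) ^ 1 * ((2 : ℝ) ^ (-ε)) ^ j) +
        4 * ((j : ℝ) ^ 0 * ((2 : ℝ) ^ (-ε)) ^ j) := by
    intro j
    have hterm : ∀ i m, μ.real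
        {ω | cond j i m ∧ ω ∈ crowdedEvent X (2 ^ (j + 1)) m (C * (1 / 2) ^ i)} ≤
          2 * ((2 : ℝ) ^ (-ε)) ^ j := by
      intro i m
      by_cases h : cond j i m
      · simp only [h, true_and]
        refine le_trans ?_ h
        have := measureReal_exists_card_dist_lt_le hXm hXν hind
          (fun x => hball x (C * (1 / 2) ^ i) (by positivity)) (2 ^ (j + 1)) m
        push_cast at this
        exact this
      · simp only [h, false_and, Set.ofPred_false, measureReal_empty]
        positivity
    calc μ.real (bad j) ≤ ∑ _i ∈ Finset.range (2 * j + 2), ∑ _m ∈ Finset.range (j + 1),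
          2 * ((2 : ℝ) ^ (-ε)) ^ j := by
          refine (measureReal_biUnion_finset_le _ _).trans (Finset.sum_le_sum fun i _ => ?_)
          exact (measureReal_biUnion_finset_le _ _).trans (Finset.sum_le_sum fun m _ => hterm i m)
      _ = _ := by
          simp only [Finset.sum_const, Finset.card_range, nsmul_eq_mul]
          push_cast
          ring
  filter_upwards [ae_eventually_notMem_of_eventually_le hsum (Eventually.of_forall hbad)]
    with ω hω
  filter_upwards [hω] with j hj i hi m hm hcond hmem
  refine hj ?_
  simp only [bad, Set.mem_iUnion]
  exact ⟨i, Finset.mem_range.2 hi, m, Finset.mem_range.2 (Nat.lt_succ_of_le hm), hcond, hmem⟩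

theorem ae_eventually_distantChromaticNumber_le_ceil_clusterSize (hp : 1 ≤ p)
    (hXm : ∀ i, Measurable (X i)) (hXν : ∀ i, μ.map (X i) = ν) (hind : iIndepFun X μ)
    (hball : ∀ x s, 0 < s → ν.real (Metric.ball x s) ≤ M * (2 * s) ^ d) (hM : 0 < M)
    (hd : 1 ≤ d) (hr0 : ∀ᶠ n in atTop, 0 < r n) (hr1 : ∀ᶠ n in atTop, r n ≤ 1)
    (ha : ∀ n : ℕ, 0 ≤ (n : ℝ) * r n ^ d)
    (hlow : ∀ ε : ℝ, 0 < ε →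
      (fun n : ℕ => (n : ℝ) ^ (-ε)) =o[atTop] fun n : ℕ => (n : ℝ) * r n ^ d)
    (hup : (fun n : ℕ => (n : ℝ) * r n ^ d) =o[atTop] fun n : ℕ => Real.log (n : ℝ))
    {ε : ℝ} (hε : 0 < ε) (hε1 : ε ≤ 1) (l : ℕ) :
    ∀ᵐ ω ∂μ, ∀ᶠ n : ℕ in atTop,
      distantChromaticNumber (randomGeometricGraph p X r n ω) l ≤
        (⌈(1 + ε) * clusterSize (fun n : ℕ => (n : ℝ) * r n ^ d) n⌉₊ : ℕ∞) := by
  set a : ℕ → ℝ := fun n : ℕ => (n : ℝ) * r n ^ d with ha_def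
  have hl0 : (0 : ℝ) < l + 1 := by positivity
  have hlogt : Tendsto (fun n : ℕ => Real.log n) atTop atTop :=
    Real.tendsto_log_atTop.comp tendsto_natCast_atTop_atTop
  filter_upwards [ae_eventually_forall_dyadic_notMem_crowdedEvent hXm hXν hind hball hl0
    (half_pos hε)] with ω hω
  have hlog2 : Tendsto (fun n : ℕ => Nat.log 2 n) atTop atTop := by
    refine tendsto_atTop.2 fun K => ?_
    filter_upwards [eventually_ge_atTop (2 ^ K)] with n hn
    exact Nat.le_log_of_pow_le one_lt_two hn
  filter_upwards [hlog2.eventually hω, hr0, hr1, eventually_gt_atTop 0,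
    eventually_rpow_neg_le ha hlow one_pos,
    eventually_clusterSize_le_mul_log ha hlow hup (by norm_num : (0 : ℝ) < 1 / 4),
    (tendsto_clusterSize ha hlow hup).eventually_ge_atTop 0,
    hlogt.eventually_ge_atTop 4,
    eventually_mul_pow_le ha hlow hup hε hε1
      (by positivity : 0 < 2 * Real.exp 1 * (M * (4 * ((l : ℝ) + 1)) ^ d))]
    with n hgood hrn hrn1 hn hlown hk hk0 hlogn hbound
  have hn0 : (0 : ℝ) < n := by exact_mod_cast hn
  set j := Nat.log 2 n with hj
  have hj1 : 2 ^ j ≤ n := Nat.pow_log_le_self 2 hn.ne'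
  have hj2 : n < 2 ^ (j + 1) := Nat.lt_pow_succ_log_self one_lt_two n
  -- r need not be monotone, so the radius is rounded up to a power of 1/2 separately from n; this
  -- loses only a factor 2.
  obtain ⟨i, hi1, hi2⟩ := exists_nat_pow_near_of_lt_one hrn hrn1
    (by norm_num : (0 : ℝ) < 1 / 2) (by norm_num)
  -- Only these radii matter: n r_n^d ≥ 1/n and r_n^d ≤ r_n give r_n ≥ n^(-2).
  have hi : i < 2 * j + 2 := by
    have h1 : ((n : ℝ) ^ 2)⁻¹ ≤ r n := by
      have h2 : r n ^ d ≤ r n := pow_le_of_le_one hrn.le hrn1 (by omega)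
      rw [Real.rpow_neg_one] at hlown
      calc ((n : ℝ) ^ 2)⁻¹ = (n : ℝ)⁻¹ * (n : ℝ)⁻¹ := by rw [sq, mul_inv]
        _ ≤ (n : ℝ)⁻¹ * (n * r n ^ d) := by gcongr
        _ = r n ^ d := by field_simp
        _ ≤ r n := h2
    have h3 : (2 : ℝ) ^ i ≤ (n : ℝ) ^ 2 := by
      have h4 := h1.trans hi2
      rw [one_div, inv_pow] at h4
      exact (inv_le_inv₀ (by positivity) (by positivity)).1 h4
    have h5 : 2 ^ i < 2 ^ (2 * j + 2) := by
      have h6 : 2 ^ i ≤ n ^ 2 := by exact_mod_cast h3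
      calc 2 ^ i ≤ n ^ 2 := h6
        _ < (2 ^ (j + 1)) ^ 2 := Nat.pow_lt_pow_left hj2 two_ne_zero
        _ = 2 ^ (2 * j + 2) := by rw [← pow_mul]; congr 1; ring
    exact (Nat.pow_lt_pow_iff_right one_lt_two).1 h5
  set m := ⌈(1 + ε) * clusterSize a n⌉₊ with hm
  have hmj : m ≤ j := by
    have h1 : (m : ℝ) < (1 + ε) * clusterSize a n + 1 := Nat.ceil_lt_add_one (by positivity)
    have h2 : Real.log n ≤ j + 1 := by
      have h3 : Real.log n ≤ Real.log ((2 : ℝ) ^ (j + 1)) :=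
        Real.log_le_log hn0 (by exact_mod_cast hj2.le)
      rw [Real.log_pow] at h3
      push_cast at h3
      have h4 : Real.log 2 ≤ 1 := by linarith [Real.log_two_lt_d9]
      have h5 : (0 : ℝ) ≤ (j : ℝ) + 1 := by positivity
      nlinarith
    have h6 : (m : ℝ) ≤ j := by nlinarith
    exact_mod_cast h6
  have hNn : (2 : ℝ) ^ (j + 1) ≤ 2 * n := by
    rw [pow_succ, mul_comm]
    have : (2 : ℝ) ^ j ≤ n := by exact_mod_cast hj1
    linarith
  have hcond : 2 ^ (j + 1) * ((2 ^ (j + 1) : ℕ).choose m *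
      (M * (2 * ((l + 1) * (1 / 2) ^ i)) ^ d) ^ m) ≤ 2 * ((2 : ℝ) ^ (-(ε / 2))) ^ j := by
    have h1 : M * (2 * (((l : ℝ) + 1) * (1 / 2) ^ i)) ^ d ≤
        M * ((4 * ((l : ℝ) + 1)) ^ d * r n ^ d) := by
      rw [← mul_pow]
      rw [pow_succ] at hi1
      have : (1 / 2 : ℝ) ^ i ≤ 2 * r n := by linarith
      refine mul_le_mul_of_nonneg_left (pow_le_pow_left₀ (by positivity) ?_ d) hM.le
      nlinarith
    have h2 : ((2 ^ (j + 1) : ℕ).choose m : ℝ) ≤ (Real.exp 1 * (2 * n) / m) ^ m := by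
      refine (choose_le_exp_mul_div_pow _ _).trans ?_
      push_cast
      gcongr
    calc _ ≤ 2 * (n : ℝ) * ((Real.exp 1 * (2 * n) / m) ^ m *
          (M * ((4 * ((l : ℝ) + 1)) ^ d * r n ^ d)) ^ m) := by gcongr
      _ = 2 * (n * (2 * Real.exp 1 * (M * (4 * ((l : ℝ) + 1)) ^ d) * a n / m) ^ m) := by
        rw [← mul_pow, mul_assoc]
        congr 3
        simp only [ha_def]
        ring
      _ ≤ 2 * (n : ℝ) ^ (-(ε / 2)) := by
        have := hbound m (Nat.le_ceil _)
        linarith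
      _ ≤ 2 * ((2 : ℝ) ^ (-(ε / 2))) ^ j := by
        rw [← Real.rpow_natCast, ← Real.rpow_mul zero_le_two, mul_comm (-(ε / 2)),
          Real.rpow_mul zero_le_two, Real.rpow_natCast]
        refine mul_le_mul_of_nonneg_left ?_ zero_le_two
        exact Real.rpow_le_rpow_of_nonpos (by positivity) (by exact_mod_cast hj1)
          (by linarith)
  have hnot := hgood i hi m hmj hcond
  refine distantChromaticNumber_geometricGraph_le hp (fun i : Fin n => X i ω) hrn.le
    (R := (l + 1) * (1 / 2) ^ i) ?_ m ?_
  · have hρ : (0 : ℝ) < (1 / 2) ^ i := by positivity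
    nlinarith [mul_le_mul_of_nonneg_left hi2 (Nat.cast_nonneg (α := ℝ) l)]
  · exact ncard_lt_of_forall_not (fun i => X i ω) hj2.le hnot

end UpperBound

/-! ### From the two bounds to the ratio. -/

section Ratio

theorem div_toNat_mem_Icc {x y : ℕ∞} {u w : ℕ} {η : ℝ} (hu : 0 < u) (hux : (u : ℕ∞) ≤ x)
    (hxy : x ≤ y) (hyw : y ≤ (w : ℕ∞)) (hwu : (w : ℝ) ≤ (1 + η) * u) (hη : 0 ≤ η) :
    1 ≤ (y.toNat : ℝ) / (x.toNat : ℝ) ∧ (y.toNat : ℝ) / (x.toNat : ℝ) ≤ 1 + η := by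
  lift y to ℕ using ne_top_of_le_ne_top (ENat.natCast_ne_top w) hyw
  lift x to ℕ using ne_top_of_le_ne_top (ENat.natCast_ne_top y) hxy
  simp only [ENat.toNat_natCast]
  have h1 : u ≤ x := by exact_mod_cast hux
  have h2 : x ≤ y := by exact_mod_cast hxy
  have h3 : y ≤ w := by exact_mod_cast hyw
  have h1' : (u : ℝ) ≤ x := by exact_mod_cast h1
  have h2' : (x : ℝ) ≤ y := by exact_mod_cast h2
  have h3' : (y : ℝ) ≤ w := by exact_mod_cast h3
  have hx : (0 : ℝ) < x := by exact_mod_cast hu.trans_le h1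
  refine ⟨(one_le_div hx).2 h2', (div_le_iff₀ hx).2 ?_⟩
  nlinarith

/-- With relative errors η/4, the gap (1+η)((1-η/4)k - 1) - ((1+η/4)k + 1) is at least ηk/4 - 3, so
ηk ≥ 12 suffices. -/
theorem eventually_ceil_le_mul_floor {k : ℕ → ℝ} (hk : Tendsto k atTop atTop) {η : ℝ}
    (hη : 0 < η) (hη1 : η ≤ 1) :
    ∀ᶠ n in atTop, 0 < ⌊(1 - η / 4) * k n⌋₊ ∧
      (⌈(1 + η / 4) * k n⌉₊ : ℝ) ≤ (1 + η) * ⌊(1 - η / 4) * k n⌋₊ := by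
  filter_upwards [hk.eventually_ge_atTop (12 / η)] with n hn
  rw [div_le_iff₀ hη] at hn
  have hk0 : 0 < k n := by nlinarith
  have h1 := Nat.ceil_lt_add_one (a := (1 + η / 4) * k n) (by positivity)
  have h2 := Nat.lt_floor_add_one ((1 - η / 4) * k n)
  have h3 : (1 - η / 4) * k n - 1 ≤ (⌊(1 - η / 4) * k n⌋₊ : ℝ) := by linarith
  refine ⟨Nat.floor_pos.2 (by nlinarith), ?_⟩
  have h4 := mul_le_mul_of_nonneg_left h3 (by linarith : 0 ≤ 1 + η)
  have h5 : 0 ≤ (1 - η) * (η * k n) := by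
    have : 0 ≤ 1 - η := by linarith
    positivity
  nlinarith

end Ratio

theorem theorem4 {Ω : Type*} [MeasurableSpace Ω] (μ : Measure Ω) [IsProbabilityMeasure μ]
    (d : ℕ) (p : ℝ≥0∞) (hp : 1 ≤ p)
    (f : (Fin d → ℝ) → ℝ) (hf_meas : Measurable f) (hf_nonneg : ∀ x, 0 ≤ f x)
    (hf_bdd : ∃ M : ℝ, ∀ᵐ x, f x ≤ M)
    (X : ℕ → Ω → Fin d → ℝ)
    (hX_law : ∀ i, HasLaw (X i) (volume.withDensity fun x => ENNReal.ofReal (f x)) μ)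
    (hX_indep : iIndepFun X μ)
    (r : ℕ → ℝ) (hr_nonneg : ∀ n, 0 ≤ r n) (hr_lim : Tendsto r atTop (𝓝 0))
    (hr_lower : ∀ ε : ℝ, 0 < ε →
      (fun n : ℕ => (n : ℝ) ^ (-ε)) =o[atTop] fun n : ℕ => (n : ℝ) * r n ^ d)
    (hr_upper : (fun n : ℕ => (n : ℝ) * r n ^ d) =o[atTop] fun n : ℕ => Real.log (n : ℝ))
    (l : ℕ) (hl : 1 ≤ l) :
    ∀ᵐ ω ∂μ, Tendsto
      (fun n : ℕ =>
        ((distantChromaticNumber (randomGeometricGraph p X r n ω) l).toNat : ℝ) /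
          ((randomGeometricGraph p X r n ω).chromaticNumber.toNat : ℝ))
      atTop (𝓝 1) := by
  -- For d = 0 the mean count would be n, which is not o(log n).
  have hd : 1 ≤ d := by
    rcases Nat.eq_zero_or_pos d with rfl | h
    · exfalso
      have h1 := eventually_le_mul_log (a := fun n : ℕ => (n : ℝ) * r n ^ 0)
        (fun n => by simp) hr_upper one_pos
      obtain ⟨n, h2, h3⟩ := (h1.and (eventually_gt_atTop 0)).exists
      have h4 := Real.log_le_sub_one_of_pos (x := (n : ℝ)) (by exact_mod_cast h3)
      simp only [pow_zero, mul_one, one_mul] at h2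
      linarith
    · exact h
  have ha : ∀ n : ℕ, 0 ≤ (n : ℝ) * r n ^ d := fun n => by
    have := hr_nonneg n
    positivity
  have hr0 : ∀ᶠ n in atTop, 0 < r n := by
    filter_upwards [eventually_pos_of_isLittleO ha hr_lower] with n hn
    refine (hr_nonneg n).lt_of_ne fun h => ?_
    rw [← h, zero_pow (by omega), mul_zero] at hn
    exact lt_irrefl _ hn
  have hr1 : ∀ᶠ n in atTop, r n ≤ 1 := hr_lim.eventually_le_const one_pos
  obtain ⟨M, hM⟩ := hf_bdd
  set ν : Measure (Fin d → ℝ) := volume.withDensity fun x => ENNReal.ofReal (f x) with hν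
  have hball : ∀ x s, 0 < s → ν.real (Metric.ball x s) ≤ max M 1 * (2 * s) ^ d :=
    fun x s hs => withDensity_ball_le hM hν x hs
  have hM0 : 0 < max M 1 := by positivity
  -- `HasLaw` gives only a.e. measurability; measurable versions agree with X for all indices at
  -- once outside a null set.
  let Y : ℕ → Ω → Fin d → ℝ := fun i => (hX_law i).aemeasurable.mk (X i)
  have hXY : ∀ i, X i =ᵐ[μ] Y i := fun i => (hX_law i).aemeasurable.ae_eq_mk
  have hYm : ∀ i, Measurable (Y i) := fun i => (hX_law i).aemeasurable.measurable_mk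
  have hYν : ∀ i, μ.map (Y i) = ν := fun i =>
    (Measure.map_congr (hXY i)).symm.trans (hX_law i).map_eq
  have hYind : iIndepFun Y μ := hX_indep.congr hXY
  -- Countably many error levels η = 1/(t+1), so that a single null set serves them all.
  have hη : ∀ t : ℕ, 0 < 1 / ((t : ℝ) + 1) ∧ 1 / ((t : ℝ) + 1) ≤ 1 := fun t =>
    ⟨by positivity, (div_le_one (by positivity)).2 (by linarith [Nat.cast_nonneg (α := ℝ) t])⟩
  have hlower := ae_all_iff.2 fun t : ℕ =>
    ae_eventually_floor_clusterSize_le_chromaticNumber hp hYm hYν hYind hball hM0 hr0 hr1 ha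
      hr_lower hr_upper (ε := 1 / ((t : ℝ) + 1) / 4) (by linarith [hη t]) (by linarith [hη t])
  have hupper := ae_all_iff.2 fun t : ℕ =>
    ae_eventually_distantChromaticNumber_le_ceil_clusterSize hp hYm hYν hYind hball hM0 hd hr0 hr1
      ha hr_lower hr_upper (ε := 1 / ((t : ℝ) + 1) / 4) (by linarith [hη t])
      (by linarith [hη t]) l
  have hk := tendsto_clusterSize ha hr_lower hr_upper
  filter_upwards [hlower, hupper, ae_all_iff.2 hXY] with ω h1 h2 h3
  have hG : ∀ n, randomGeometricGraph p X r n ω = randomGeometricGraph p Y r n ω := fun n => by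
    simp only [randomGeometricGraph, h3]
  simp only [hG]
  refine Metric.tendsto_atTop'.2 fun δ hδ => ?_
  obtain ⟨t, ht⟩ := exists_nat_one_div_lt hδ
  obtain ⟨N, hN⟩ := eventually_atTop.1 ((h1 t).and ((h2 t).and
    (eventually_ceil_le_mul_floor hk (hη t).1 (hη t).2)))
  refine ⟨N, fun n hn => ?_⟩
  obtain ⟨hx, hy, hpos, hle⟩ := hN n hn.le
  obtain ⟨e1, e2⟩ := div_toNat_mem_Icc hpos hx
    (chromaticNumber_le_distantChromaticNumber _ hl) hy hle (hη t).1.le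
  rw [Real.dist_eq, abs_of_nonneg (by linarith)]
  linarith
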